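/- Let $\mathbb{X},\mathbb{Y}$ be finite-dimensional real inner product spaces, $f:\mathbb{X}\to\mathbb{X}$ differentiable, $\Phi:\mathbb{X}\to\mathbb{Y}$ twice differentiable, and $\Theta\subset\mathbb{Y}$ closed. Let $T_\Omega$ be the Bouligand tangent cone, $N_\Omega$ the limiting (Mordukhovich) normal cone, $\mathbb{B}_\varepsilon(\cdot)$ a closed ball of radius $\varepsilon$, $\mathbb{B}$ the closed unit ball, and $d(\cdot\,;\Omega)$ the distance to $\Omega$ (equal to $\infty$ if $\Omega=\emptyset$). For a set-valued mapping $F$ put $DF(\bar a,\bar b)(u)=\{v\mid (u,v)\in T_{\mathrm{gph}\,F}(\bar a,\bar b)\}$, and for a cone $K$ put $K^*=\{v\mid\langle v,w\rangle\le 0\ \text{for all}\ w\in K\}$. Set $$\Psi(x,\lambda)=f(x)+\nabla\Phi(x)^*\lambda,\qquad \Lambda(x)=\{\lambda\mid \Psi(x,\lambda)=0,\ \lambda\in N_\Theta(\Phi(x))\},$$ $$S(v,w)=\{(x,\lambda)\mid v=\Psi(x,\lambda),\ \lambda\in N_\Theta(\Phi(x)+w)\},\qquad M_{\bar x}(v,w)=\{\lambda\mid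 (\bar x,\lambda)\in S(v,w)\}.$$ Let $(\bar x,\bar\lambda)$ satisfy $\Psi(\bar x,\bar\lambda)=0$ and $\bar\lambda\in N_\Theta(\Phi(\bar x))$, put $\bar z=\Phi(\bar x)$, and let $K=T_\Theta(\bar z)\cap\{\bar\lambda\}^\perp$. Consider the following properties. (i) $\bar\lambda$ is noncritical: the only $\xi\in\mathbb{X}$ with $0\in\nabla_x\Psi(\bar x,\bar\lambda)\xi+\nabla\Phi(\bar x)^*DN_\Theta(\bar z,\bar\lambda)(\nabla\Phi(\bar x)\xi)$ is $\xi=0$. (ii) $S$ is semi-isolatedly calm at $((0,0),(\bar x,\bar\lambda))$: there are $\varepsilon>0$, $\ell\ge0$ and neighborhoods $V$ of $0\in\mathbb{X}$ and $W$ of $0\in\mathbb{Y}$ such that for all $(v,w)\in V\times W$ $$S(v,w)\cap\mathbb{B}_\varepsilon(\bar x,\bar\lambda)\subset\big[\{\bar x\}\times\Lambda(\bar x)\big]+\ell(\|v\|+\|w\|)\mathbb{B}.$$ (iii) There are $\varepsilon>0$ and $\ell\ge0$ such that for all $(x,\lambda)\in\mathbb{B}_\varepsilon(\bar x,\bar\lambda)$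 $$\|x-\bar x\|+d(\lambda;\Lambda(\bar x))\le\ell\big(\|\Psi(x,\lambda)\|+d(\Phi(x);N_\Theta^{-1}(\lambda))\big).$$ Then the following hold. (a) (iii)$\iff$(ii)$\implies$(i). (b) Suppose that $\Theta$ is $\mathcal{C}^2$-cone reducible at $\bar z$ to a closed convex cone $C$ in a finite-dimensional space $\mathbb{E}$, that is, there are a neighborhood $\mathcal{O}$ of $\bar z$ and a $\mathcal{C}^2$-smooth mapping $h:\mathbb{Y}\to\mathbb{E}$ with $\Theta\cap\mathcal{O}=\{z\in\mathcal{O}\mid h(z)\in C\}$, $h(\bar z)=0$ and $\nabla h(\bar z)$ surjective. Suppose also that the set $K^*-[K^*\cap\ker\nabla\Phi(\bar x)^*]$ is closed, and that $M_{\bar x}$ is calm at $((0,0),\bar\lambda)$, that is, there are $\ell\ge0$ and neighborhoods $U$ of $(0,0)$ and $V$ of $\bar\lambda$ such that $M_{\bar x}(v,w)\cap V\subset\Lambda(\bar x)+\ell\|(v,w)\|\mathbb{B}$ for all $(v,w)\in U$. Then also (i)$\implies$(ii). -/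

import Mathlib

open Set Filter Topology
open scoped NNReal ENNReal Pointwise

namespace VarSys

section Cones

variable {E : Type*} [NormedAddCommGroup E] [InnerProductSpace ℝ E]

/-- The Bouligand tangent cone is Mathlib's `posTangentConeAt`: at points of the set it consists of
all limits `w` of `w k` with `x + t k • w k ∈ s` for some `t k ↓ 0`. -/
theorem mem_posTangentConeAt_iff_seq {s : Set E} {x y : E} (hx : x ∈ s) :
    y ∈ posTangentConeAt s x ↔ ∃ (t : ℕ → ℝ) (w : ℕ → E), (∀ k, 0 < t k) ∧
      Tendsto t atTop (𝓝 0) ∧ Tendsto w atTop (𝓝 y) ∧ ∀ k, x + t k • w k ∈ s := by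
  constructor
  · intro h
    by_cases hy : y = 0
    · refine ⟨fun k => 1 / ((k : ℝ) + 1), fun _ => 0, fun k => by positivity,
        tendsto_one_div_add_atTop_nhds_zero_nat, ?_, fun k => by simpa using hx⟩
      rw [hy]
      exact tendsto_const_nhds
    · obtain ⟨c, d, hd, hds, hcd⟩ := mem_tangentConeAt_iff_exists_seq.1 h
      have hne : ∀ᶠ n in atTop, c n • d n ≠ 0 := hcd.eventually_ne hy
      obtain ⟨N, hN⟩ := eventually_atTop.1 (hds.and hne)
      have hpos : ∀ k, 0 < ((c (k + N) : ℝ≥0) : ℝ) := by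
        intro k
        have h1 := (hN (k + N) (by omega)).2
        have h2 : c (k + N) ≠ 0 := fun h0 => h1 (by simp [h0])
        exact NNReal.coe_pos.2 (pos_iff_ne_zero.2 h2)
      have hdne : ∀ k, d (k + N) ≠ 0 := by
        intro k h0
        exact (hN (k + N) (by omega)).2 (by simp [h0])
      have hcd' : Tendsto (fun k => c (k + N) • d (k + N)) atTop (𝓝 y) :=
        hcd.comp (tendsto_add_atTop_nat N)
      have hd' : Tendsto (fun k => d (k + N)) atTop (𝓝 0) := hd.comp (tendsto_add_atTop_nat N)
      refine ⟨fun k => ((c (k + N) : ℝ≥0) : ℝ)⁻¹, fun k => c (k + N) • d (k + N),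
        fun k => inv_pos.2 (hpos k), ?_, hcd', fun k => ?_⟩
      · have hl : Tendsto (fun k => ‖d (k + N)‖ / ‖c (k + N) • d (k + N)‖) atTop
            (𝓝 (‖(0 : E)‖ / ‖y‖)) := hd'.norm.div hcd'.norm (norm_ne_zero_iff.2 hy)
        rw [norm_zero, zero_div] at hl
        refine hl.congr fun k => ?_
        have h1 : ‖d (k + N)‖ ≠ 0 := norm_ne_zero_iff.2 (hdne k)
        have h2 := (hpos k).ne'
        rw [NNReal.smul_def, norm_smul, Real.norm_of_nonneg (hpos k).le]
        field_simp
      · have h1 : ((c (k + N) : ℝ≥0) : ℝ)⁻¹ • c (k + N) • d (k + N) = d (k + N) := by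
          rw [NNReal.smul_def, inv_smul_smul₀ (hpos k).ne']
        simp only [h1]
        exact (hN (k + N) (by omega)).1
  · rintro ⟨t, w, ht, ht0, hw, hmem⟩
    refine mem_tangentConeAt_iff_exists_seq.2
      ⟨fun k => (Real.toNNReal (t k))⁻¹, fun k => t k • w k, ?_, Eventually.of_forall hmem, ?_⟩
    · simpa using ht0.smul hw
    · refine hw.congr fun k => ?_
      simp only [NNReal.smul_def, NNReal.coe_inv, Real.coe_toNNReal _ (ht k).le,
        inv_smul_smul₀ (ht k).ne']

/-- The regular (Fréchet) normal cone: `v` with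
`limsup ⟨v, y - x⟩ / ‖y - x‖ ≤ 0` as `y → x` inside `Ω`; empty if `x ∉ Ω`. -/
def regularNormalCone (Ω : Set E) (x : E) : Set E :=
  {v | x ∈ Ω ∧ ∀ ε : ℝ, 0 < ε → ∀ᶠ y in 𝓝[Ω] x, inner ℝ v (y - x) ≤ ε * ‖y - x‖}

/-- The limiting (Mordukhovich) normal cone; empty if `x ∉ Ω`. -/
def normalCone (Ω : Set E) (x : E) : Set E :=
  {v | x ∈ Ω ∧ ∃ (y : ℕ → E) (u : ℕ → E), Tendsto y atTop (𝓝 x) ∧ Tendsto u atTop (𝓝 v) ∧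
    ∀ k, u k ∈ regularNormalCone Ω (y k)}

/-- The inverse `N_Ω⁻¹` of the normal cone mapping. -/
def normalConeInv (Ω : Set E) (v : E) : Set E :=
  {x | v ∈ normalCone Ω x}

/-- The polar of a cone `K`. -/
def polarCone (K : Set E) : Set E :=
  {v | ∀ w ∈ K, inner ℝ v w ≤ 0}

/-- The critical cone to `Ω` at `z` for `lam`: `T_Ω(z) ∩ {lam}^⊥`. -/
def criticalCone (Ω : Set E) (z lam : E) : Set E :=
  posTangentConeAt Ω z ∩ {w | inner ℝ lam w = 0}

end Cones

section SetValued

variable {A B : Type*} [NormedAddCommGroup A] [NormedSpace ℝ A]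
  [NormedAddCommGroup B] [NormedSpace ℝ B]

/-- The graphical derivative `DF(a, b)` of a set-valued mapping `F`. -/
def graphicalDeriv (F : A → Set B) (a : A) (b : B) (u : A) : Set B :=
  {v | (u, v) ∈ posTangentConeAt {p : A × B | p.2 ∈ F p.1} (a, b)}

/-- Calmness of a set-valued mapping `F` at `(a, b)`. -/
def IsCalmAt (F : A → Set B) (a : A) (b : B) : Prop :=
  ∃ ℓ : ℝ, 0 ≤ ℓ ∧ ∃ U ∈ 𝓝 a, ∃ V ∈ 𝓝 b, ∀ x ∈ U,
    F x ∩ V ⊆ F a + Metric.closedBall (0 : B) (ℓ * ‖x - a‖)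

end SetValued

section Reducible

variable {Y E : Type*} [NormedAddCommGroup Y] [InnerProductSpace ℝ Y]
  [NormedAddCommGroup E] [InnerProductSpace ℝ E]

/-- `Θ` is `C²`-cone reducible at `z ∈ Θ` to the closed convex cone `C`
(a `ProperCone` is a closed convex cone containing `0`). -/
def IsC2ConeReducibleAt (Θ : Set Y) (z : Y) (C : ProperCone ℝ E) : Prop :=
  z ∈ Θ ∧ ∃ O ∈ 𝓝 z, ∃ h : Y → E, ContDiff ℝ 2 h ∧
    Θ ∩ O = {y | y ∈ O ∧ h y ∈ C} ∧ h z = 0 ∧ Function.Surjective (fderiv ℝ h z)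

end Reducible

section System

variable {X Y : Type*} [NormedAddCommGroup X] [InnerProductSpace ℝ X] [FiniteDimensional ℝ X]
  [NormedAddCommGroup Y] [InnerProductSpace ℝ Y] [FiniteDimensional ℝ Y]

/-- The adjoint `∇Φ(x)^* : Y → X` of the derivative of `Φ` at `x`. -/
noncomputable def derivAdj (Φ : X → Y) (x : X) : Y →ₗ[ℝ] X :=
  LinearMap.adjoint (fderiv ℝ Φ x : X →ₗ[ℝ] Y)

/-- `Ψ(x, lam) = f(x) + ∇Φ(x)^* lam`. -/
noncomputable def Psi (f : X → X) (Φ : X → Y) (x : X) (lam : Y) : X :=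
  f x + derivAdj Φ x lam

/-- `(x, lam)` solves the generalized KKT system `Ψ(x, lam) = 0`, `lam ∈ N_Θ(Φ(x))`. -/
def IsKKTSolution (f : X → X) (Φ : X → Y) (Θ : Set Y) (x : X) (lam : Y) : Prop :=
  Psi f Φ x lam = 0 ∧ lam ∈ normalCone Θ (Φ x)

/-- The set `Λ(x)` of Lagrange multipliers at `x`. -/
def multipliers (f : X → X) (Φ : X → Y) (Θ : Set Y) (x : X) : Set Y :=
  {lam | IsKKTSolution f Φ Θ x lam}

/-- The set-valued mapping `G(x, lam) = (Ψ(x, lam), -Φ(x)) + {0} × N_Θ⁻¹(lam)`. -/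
def kktMap (f : X → X) (Φ : X → Y) (Θ : Set Y) (x : X) (lam : Y) : Set (X × Y) :=
  {(Psi f Φ x lam, -Φ x)} + ({0} ×ˢ normalConeInv Θ lam)

/-- The solution map `S(v, w) = {(x, lam) | (v, w) ∈ G(x, lam)}` of the canonical perturbation. -/
def solutionMap (f : X → X) (Φ : X → Y) (Θ : Set Y) (p : X × Y) : Set (X × Y) :=
  {q | p ∈ kktMap f Φ Θ q.1 q.2}

/-- The multiplier mapping `M_x(v, w) = {lam | (v, w) ∈ G(x, lam)}`. -/
def multiplierMap (f : X → X) (Φ : X → Y) (Θ : Set Y) (x : X) (p : X × Y) : Set Y :=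
  {lam | p ∈ kktMap f Φ Θ x lam}

/-- `lam` is noncritical: `0 ∈ ∇ₓΨ(x, lam) ξ + ∇Φ(x)^* DN_Θ(Φ(x), lam)(∇Φ(x) ξ)` only for
`ξ = 0`. -/
def IsNoncritical (f : X → X) (Φ : X → Y) (Θ : Set Y) (x : X) (lam : Y) : Prop :=
  ∀ ξ : X,
    (∃ η ∈ graphicalDeriv (normalCone Θ) (Φ x) lam (fderiv ℝ Φ x ξ),
      fderiv ℝ (fun y => Psi f Φ y lam) x ξ + derivAdj Φ x η = 0) → ξ = 0

/-- Semi-isolated calmness of the solution map at `((0, 0), (x, lam))`. -/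
def IsSemiIsolatedlyCalm (f : X → X) (Φ : X → Y) (Θ : Set Y) (x : X) (lam : Y) : Prop :=
  ∃ ε : ℝ, 0 < ε ∧ ∃ ℓ : ℝ, 0 ≤ ℓ ∧ ∃ V ∈ 𝓝 (0 : X), ∃ W ∈ 𝓝 (0 : Y), ∀ v ∈ V, ∀ w ∈ W,
    solutionMap f Φ Θ (v, w) ∩ Metric.closedBall (x, lam) ε ⊆
      ({x} ×ˢ multipliers f Φ Θ x) + Metric.closedBall (0 : X × Y) (ℓ * (‖v‖ + ‖w‖))

/-- The error bound
`‖y - x‖ + d(μ, Λ(x)) ≤ ℓ (‖Ψ(y, μ)‖ + d(Φ(y), N_Θ⁻¹(μ)))` for all `(y, μ)` near `(x, lam)`.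
It is stated in `[0, ∞]` since the distance to an empty set `N_Θ⁻¹(μ)` is `∞`. -/
def HasErrorBound (f : X → X) (Φ : X → Y) (Θ : Set Y) (x : X) (lam : Y) : Prop :=
  ∃ ε : ℝ, 0 < ε ∧ ∃ ℓ : ℝ≥0, ∀ p ∈ Metric.closedBall (x, lam) ε,
    ‖p.1 - x‖ₑ + Metric.infEDist p.2 (multipliers f Φ Θ x) ≤
      ℓ * (‖Psi f Φ p.1 p.2‖ₑ + Metric.infEDist (Φ p.1) (normalConeInv Θ p.2))

/-- The set `K^* - (K^* ∩ ker ∇Φ(x)^*)`, where `K` is the critical cone to `Θ` at `Φ(x)` for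
`lam`. -/
def polarDiffSet (Φ : X → Y) (Θ : Set Y) (x : X) (lam : Y) : Set Y :=
  polarCone (criticalCone Θ (Φ x) lam) -
    (polarCone (criticalCone Θ (Φ x) lam) ∩ {η | derivAdj Φ x η = 0})

end System

end VarSys

/-!
Semi-isolated calmness and the error bound are two ways of saying that, for all `(x, λ, w)` near
`(xbar, lbar, 0)` with `λ ∈ N_Θ(Φ(x) + w)`, the residual `‖Ψ(x, λ)‖ + ‖w‖` dominates both
`‖x - xbar‖` and the distance of `λ` to the multipliers (`HasResidualBound`). A nonzero `ξ` that
violates noncriticality produces points `xbar + t ξ`, `lbar + t η(t)` with residual `o(t)`, so the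
residual bound implies noncriticality (`HasResidualBound.isNoncritical`).

For the converse let `h` reduce `Θ` near `z = Φ(xbar)` to the cone `C`, and put `A = ∇h(z)`. Near
`z` the normals to `Θ` are the vectors `∇h(y)^* μ` with `μ ∈ N_C(h(y))`
(`LocalReduction.eventually_normalCone`), and with `lbar = A^* μ` the graphical derivative of `N_Θ`
at `(z, lbar)` contains the curvature term `∇²⟨μ, h⟩(z) u` plus the normals at `u` to the critical
cone `K` (`LocalReduction.mem_graphicalDeriv_normalCone`). The latter rests on the projection onto
`C`, which gives curves in the graph of `N_C` (`exists_curve_in_graph_of_normals`).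

Suppose that `x k - xbar` is not bounded by the residual, and divide by `t k = ‖x k - xbar‖`.
Calmness of the multiplier mapping supplies multipliers `λ' k` with `‖λ k - λ' k‖ = O(t k)`
(`exists_multiplier_of_isCalmAt`). Limits `ξ` of `(x k - xbar) / t k` and `η` of
`(λ k - λ' k) / t k` satisfy the linearized equation. After removal of the curvature term, `η` is a
limit of elements of `K^* - (K^* ∩ ker ∇Φ(xbar)^*)`, hence of the form `η₁ - η₂` in this closed set.
Passing from `η` to `η + η₂` does not affect the linearized equation, since `∇Φ(xbar)^* η₂ = 0`,
and `η₁` is a normal to `K` at `∇Φ(xbar) ξ`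
(`LocalReduction.exists_sub_mem_graphicalDeriv`). So `ξ` is a unit vector that contradicts
noncriticality (`LocalReduction.exists_norm_sub_le`).
-/

namespace VarSys

/-! ### Normal cones, tangent vectors and difference quotients -/

section NormalCone

variable {E : Type*} [NormedAddCommGroup E] [InnerProductSpace ℝ E]

theorem isClosed_normalCone (Ω : Set E) (x : E) : IsClosed (normalCone Ω x) := by
  by_cases hx : x ∈ Ω
  · have : normalCone Ω x =
        (fun v : E => (x, v)) ⁻¹' closure {p : E × E | p.2 ∈ regularNormalCone Ω p.1} := by
      ext v
      simp only [mem_preimage, mem_closure_iff_seq_limit, normalCone, mem_ofPred_eq]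
      constructor
      · rintro ⟨-, y, u, hy, hu, h⟩
        exact ⟨fun k => (y k, u k), h, hy.prodMk_nhds hu⟩
      · rintro ⟨p, hp, hlim⟩
        rw [nhds_prod_eq] at hlim
        exact ⟨hx, fun k => (p k).1, fun k => (p k).2, tendsto_fst.comp hlim,
          tendsto_snd.comp hlim, hp⟩
    rw [this]
    exact isClosed_closure.preimage (by fun_prop)
  · have : normalCone Ω x = ∅ := by
      ext v
      simp [normalCone, hx]
    rw [this]
    exact isClosed_empty

theorem regularNormalCone_subset_normalCone (Ω : Set E) (x : E) :
    regularNormalCone Ω x ⊆ normalCone Ω x := fun v hv =>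
  ⟨hv.1, fun _ => x, fun _ => v, tendsto_const_nhds, tendsto_const_nhds, fun _ => hv⟩

end NormalCone

section Tangent

variable {E : Type*} [NormedAddCommGroup E] [NormedSpace ℝ E]

/-- A tangent vector is the limit of difference quotients along some sequence of scales `t k ↓ 0`.
In contrast to `mem_posTangentConeAt_iff_seq` this applies in any normed space, in particular in a
product with the sup norm, where graphs of set-valued mappings live. -/
theorem exists_seq_of_mem_posTangentConeAt {s : Set E} {x y : E} (hy0 : y ≠ 0)
    (h : y ∈ posTangentConeAt s x) : ∃ (t : ℕ → ℝ) (w : ℕ → E), (∀ᶠ k in atTop, 0 < t k) ∧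
      Tendsto t atTop (𝓝 0) ∧ Tendsto w atTop (𝓝 y) ∧ ∀ᶠ k in atTop, x + t k • w k ∈ s := by
  obtain ⟨c, d, hd, hds, hcd⟩ := mem_tangentConeAt_iff_exists_seq.1 h
  have hne : ∀ᶠ n in atTop, c n • d n ≠ 0 := hcd.eventually_ne hy0
  have hc : ∀ᶠ n in atTop, c n ≠ 0 := hne.mono fun n hn h0 => hn (by simp [h0])
  refine ⟨fun k => ((c k : ℝ≥0) : ℝ)⁻¹, fun k => c k • d k, ?_, ?_, hcd, ?_⟩
  · filter_upwards [hc] with k hk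
    exact inv_pos.2 (NNReal.coe_pos.2 (pos_iff_ne_zero.2 hk))
  · have hl : Tendsto (fun k => ‖d k‖ / ‖c k • d k‖) atTop (𝓝 (‖(0 : E)‖ / ‖y‖)) :=
      hd.norm.div hcd.norm (norm_ne_zero_iff.2 hy0)
    rw [norm_zero, zero_div] at hl
    refine hl.congr' ?_
    filter_upwards [hne, hc] with k hk hck
    have h1 : ‖d k‖ ≠ 0 := norm_ne_zero_iff.2 fun h0 => hk (by simp [h0])
    have h2 : ((c k : ℝ≥0) : ℝ) ≠ 0 := by exact_mod_cast hck
    rw [NNReal.smul_def, norm_smul, Real.norm_of_nonneg (c k).coe_nonneg]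
    field_simp
  · filter_upwards [hds, hc] with k hk hck
    have h2 : ((c k : ℝ≥0) : ℝ) ≠ 0 := by exact_mod_cast hck
    simp only [NNReal.smul_def, inv_smul_smul₀ h2]
    exact hk

theorem mem_posTangentConeAt_of_tendsto {ι : Type*} {l : Filter ι} [l.NeBot] {s : Set E} {x y : E}
    {t : ι → ℝ} {w : ι → E} (ht : ∀ᶠ k in l, 0 < t k) (ht0 : Tendsto t l (𝓝 0))
    (hw : Tendsto w l (𝓝 y)) (hmem : ∀ᶠ k in l, x + t k • w k ∈ s) :
    y ∈ posTangentConeAt s x := by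
  refine mem_tangentConeAt_of_seq l (fun k => (Real.toNNReal (t k))⁻¹) (fun k => t k • w k)
    ?_ hmem ?_
  · simpa using ht0.smul hw
  · refine hw.congr' ?_
    filter_upwards [ht] with k hk
    simp only [NNReal.smul_def, NNReal.coe_inv, Real.coe_toNNReal _ hk.le,
      inv_smul_smul₀ hk.ne']

theorem tendsto_clm_apply {F ι : Type*} [NormedAddCommGroup F] [NormedSpace ℝ F]
    {l : Filter ι} {B : ι → E →L[ℝ] F} {B₀ : E →L[ℝ] F}
    {e : ι → E} {e₀ : E} (hB : Tendsto B l (𝓝 B₀)) (he : Tendsto e l (𝓝 e₀)) :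
    Tendsto (fun k => B k (e k)) l (𝓝 (B₀ e₀)) :=
  (isBoundedBilinearMap_apply.continuous.tendsto (B₀, e₀)).comp (hB.prodMk_nhds he)

/-- Difference quotients of a differentiable map along a converging sequence of directions. -/
theorem tendsto_inv_smul_sub {F ι : Type*} [NormedAddCommGroup F] [NormedSpace ℝ F]
    {l : Filter ι} {g : E → F} {g' : E →L[ℝ] F} {a u : E}
    (hg : HasFDerivAt g g' a) {t : ι → ℝ} {w : ι → E} (ht : ∀ᶠ k in l, 0 < t k)
    (ht0 : Tendsto t l (𝓝 0)) (hw : Tendsto w l (𝓝 u)) :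
    Tendsto (fun k => (t k)⁻¹ • (g (a + t k • w k) - g a)) l (𝓝 (g' u)) := by
  refine (hasFDerivWithinAt_univ.2 hg).lim (by simpa using ht0.smul hw)
    (.of_forall fun _ => mem_univ _) (hw.congr' ?_)
  filter_upwards [ht] with k hk
  rw [inv_smul_smul₀ hk.ne']

end Tangent

/-! ### Semi-isolated calmness, the error bound and noncriticality -/

section System

variable {X Y : Type*} [NormedAddCommGroup X] [InnerProductSpace ℝ X] [FiniteDimensional ℝ X]
  [NormedAddCommGroup Y] [InnerProductSpace ℝ Y] [FiniteDimensional ℝ Y]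
  {f : X → X} {Φ : X → Y} {Θ : Set Y} {xbar : X} {lbar : Y}

theorem derivAdj_apply (Φ : X → Y) (x : X) (lam : Y) :
    derivAdj Φ x lam = ContinuousLinearMap.adjoint (fderiv ℝ Φ x) lam := by
  refine ext_inner_right ℝ fun v => ?_
  rw [derivAdj, LinearMap.adjoint_inner_left, ContinuousLinearMap.adjoint_inner_left]
  rfl

theorem Psi_eq (f : X → X) (Φ : X → Y) (x : X) (lam : Y) :
    Psi f Φ x lam = f x + ContinuousLinearMap.adjoint (fderiv ℝ Φ x) lam := by
  rw [Psi, derivAdj_apply]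

theorem mem_kktMap {x : X} {lam : Y} {v : X} {w : Y} :
    (v, w) ∈ kktMap f Φ Θ x lam ↔ v = Psi f Φ x lam ∧ lam ∈ normalCone Θ (Φ x + w) := by
  simp only [kktMap, singleton_add, mem_image, mem_prod, mem_singleton_iff, normalConeInv,
    mem_ofPred_eq, Prod.exists, Prod.mk_add_mk, Prod.mk.injEq]
  constructor
  · rintro ⟨a, b, ⟨rfl, hb⟩, rfl, rfl⟩
    exact ⟨by simp, by simpa using hb⟩
  · rintro ⟨rfl, h⟩
    exact ⟨0, Φ x + w, ⟨rfl, h⟩, by simp, by simp⟩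

theorem multiplierMap_zero (f : X → X) (Φ : X → Y) (Θ : Set Y) (x : X) :
    multiplierMap f Φ Θ x (0, 0) = multipliers f Φ Θ x := by
  ext lam
  simp only [multiplierMap, multipliers, IsKKTSolution, mem_ofPred_eq, mem_kktMap, add_zero,
    eq_comm (a := (0 : X))]

theorem isClosed_multipliers (f : X → X) (Φ : X → Y) (Θ : Set Y) (x : X) :
    IsClosed (multipliers f Φ Θ x) := by
  have h1 : IsClosed {lam : Y | Psi f Φ x lam = 0} := by
    simp only [Psi_eq]
    exact isClosed_eq (by fun_prop) continuous_const
  exact h1.inter (isClosed_normalCone Θ (Φ x))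

theorem continuous_Psi (hf : Differentiable ℝ f) (hΦ2 : Differentiable ℝ (fderiv ℝ Φ)) :
    Continuous fun p : X × Y => Psi f Φ p.1 p.2 := by
  simp only [Psi_eq]
  have h1 : Continuous fun p : X × Y => ContinuousLinearMap.adjoint (fderiv ℝ Φ p.1) :=
    ContinuousLinearMap.adjoint.continuous.comp (hΦ2.continuous.comp continuous_fst)
  exact (hf.continuous.comp continuous_fst).add (h1.clm_apply continuous_snd)

/-- The common form of semi-isolated calmness and of the error bound: for all `(x, lam, w)` near
`(xbar, lbar, 0)` with `lam ∈ N_Θ(Φ(x) + w)`, both `‖x - xbar‖` and the distance of `lam` to some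
multiplier are bounded by a multiple of the residual `‖Ψ(x, lam)‖ + ‖w‖`. -/
def HasResidualBound (f : X → X) (Φ : X → Y) (Θ : Set Y) (xbar : X) (lbar : Y) : Prop :=
  ∃ ℓ : ℝ, 0 ≤ ℓ ∧ ∀ᶠ p : X × Y × Y in 𝓝 (xbar, lbar, 0), p.2.1 ∈ normalCone Θ (Φ p.1 + p.2.2) →
    ‖p.1 - xbar‖ ≤ ℓ * (‖Psi f Φ p.1 p.2.1‖ + ‖p.2.2‖) ∧
    ∃ μ ∈ multipliers f Φ Θ xbar, ‖p.2.1 - μ‖ ≤ ℓ * (‖Psi f Φ p.1 p.2.1‖ + ‖p.2.2‖)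

theorem isSemiIsolatedlyCalm_iff_hasResidualBound (hf : Differentiable ℝ f)
    (hΦ2 : Differentiable ℝ (fderiv ℝ Φ)) (hsol : IsKKTSolution f Φ Θ xbar lbar) :
    IsSemiIsolatedlyCalm f Φ Θ xbar lbar ↔ HasResidualBound f Φ Θ xbar lbar := by
  have key : ∀ (x : X) (lam : Y) (r : ℝ),
      ((x, lam) ∈ ({xbar} ×ˢ multipliers f Φ Θ xbar) + Metric.closedBall (0 : X × Y) r) ↔
        ‖x - xbar‖ ≤ r ∧ ∃ μ ∈ multipliers f Φ Θ xbar, ‖lam - μ‖ ≤ r := by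
    intro x lam r
    rw [Set.mem_add]
    constructor
    · rintro ⟨⟨a, μ⟩, ⟨ha, hμ⟩, ⟨b, c⟩, hb, hbc⟩
      simp only [mem_singleton_iff] at ha hμ
      simp only [Prod.mk_add_mk, Prod.mk.injEq] at hbc
      obtain ⟨rfl, rfl⟩ := hbc
      rw [mem_closedBall_zero_iff, Prod.norm_def, max_le_iff] at hb
      subst ha
      exact ⟨by simpa using hb.1, μ, hμ, by simpa using hb.2⟩
    · rintro ⟨h1, μ, hμ, h2⟩
      refine ⟨(xbar, μ), ⟨rfl, hμ⟩, (x - xbar, lam - μ), ?_, by simp⟩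
      rw [mem_closedBall_zero_iff, Prod.norm_def, max_le_iff]
      exact ⟨h1, h2⟩
  constructor
  · rintro ⟨ε, hε, ℓ, hℓ, V, hV, W, hW, h⟩
    refine ⟨ℓ, hℓ, ?_⟩
    have hPsi : Continuous fun p : X × Y × Y => Psi f Φ p.1 p.2.1 :=
      (continuous_Psi hf hΦ2).comp (continuous_fst.prodMk (continuous_fst.comp continuous_snd))
    have e1 : ∀ᶠ p : X × Y × Y in 𝓝 (xbar, lbar, 0), Psi f Φ p.1 p.2.1 ∈ V :=
      hPsi.continuousAt.eventually_mem (by simpa [hsol.1] using hV)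
    have e2 : ∀ᶠ p : X × Y × Y in 𝓝 (xbar, lbar, 0), p.2.2 ∈ W :=
      (continuous_snd.comp continuous_snd).continuousAt.eventually_mem hW
    have e3 : ∀ᶠ p : X × Y × Y in 𝓝 (xbar, lbar, 0),
        (p.1, p.2.1) ∈ Metric.closedBall (xbar, lbar) ε :=
      (continuous_fst.prodMk (continuous_fst.comp continuous_snd)).continuousAt.eventually_mem
        (Metric.closedBall_mem_nhds _ hε)
    filter_upwards [e1, e2, e3] with p h1 h2 h3 h4
    exact (key _ _ _).1 (h _ h1 _ h2 ⟨mem_kktMap.2 ⟨rfl, h4⟩, h3⟩)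
  · rintro ⟨ℓ, hℓ, h⟩
    obtain ⟨δ, hδ, hb⟩ := Metric.nhds_basis_closedBall.eventually_iff.1 h
    refine ⟨δ, hδ, ℓ, hℓ, univ, univ_mem, Metric.closedBall 0 δ, Metric.closedBall_mem_nhds _ hδ,
      ?_⟩
    rintro v - w hw ⟨x, lam⟩ ⟨hq, hball⟩
    obtain ⟨rfl, hN⟩ := mem_kktMap.1 hq
    refine (key _ _ _).2 (hb (x := (x, lam, w)) ?_ hN)
    simp only [Metric.mem_closedBall, Prod.dist_eq, max_le_iff] at hball hw ⊢
    exact ⟨hball.1, hball.2, hw⟩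

theorem hasErrorBound_iff_hasResidualBound (hsol : IsKKTSolution f Φ Θ xbar lbar) :
    HasErrorBound f Φ Θ xbar lbar ↔ HasResidualBound f Φ Θ xbar lbar := by
  constructor
  · rintro ⟨ε, hε, ℓ, h⟩
    refine ⟨ℓ, ℓ.coe_nonneg, ?_⟩
    have e3 : ∀ᶠ p : X × Y × Y in 𝓝 (xbar, lbar, 0),
        (p.1, p.2.1) ∈ Metric.closedBall (xbar, lbar) ε :=
      (continuous_fst.prodMk (continuous_fst.comp continuous_snd)).continuousAt.eventually_mem
        (Metric.closedBall_mem_nhds _ hε)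
    filter_upwards [e3] with p hp hN
    have hd : Metric.infEDist (Φ p.1) (normalConeInv Θ p.2.1) ≤ ‖p.2.2‖ₑ := by
      refine (Metric.infEDist_le_edist_of_mem (y := Φ p.1 + p.2.2) hN).trans ?_
      rw [edist_comm, edist_eq_enorm_sub, add_sub_cancel_left]
    have hle : ‖p.1 - xbar‖ₑ + Metric.infEDist p.2.1 (multipliers f Φ Θ xbar) ≤
        ENNReal.ofReal (ℓ * (‖Psi f Φ p.1 p.2.1‖ + ‖p.2.2‖)) := by
      refine (h _ hp).trans ?_
      rw [ENNReal.ofReal_mul ℓ.coe_nonneg, ENNReal.ofReal_add (norm_nonneg _) (norm_nonneg _),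
        ENNReal.ofReal_coe_nnreal, ofReal_norm, ofReal_norm]
      gcongr
    have hr : 0 ≤ ℓ * (‖Psi f Φ p.1 p.2.1‖ + ‖p.2.2‖) := by positivity
    constructor
    · have := le_self_add.trans hle
      rwa [← ofReal_norm, ENNReal.ofReal_le_ofReal_iff hr] at this
    · obtain ⟨μ, hμ, hdist⟩ :=
        (isClosed_multipliers f Φ Θ xbar).exists_infDist_eq_dist ⟨lbar, hsol⟩ p.2.1
      refine ⟨μ, hμ, ?_⟩
      have := le_add_self.trans hle
      rw [← dist_eq_norm, ← hdist, Metric.infDist]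
      exact ENNReal.toReal_le_of_le_ofReal hr this
  · rintro ⟨ℓ, hℓ, h⟩
    obtain ⟨δ, hδ, hb⟩ := Metric.nhds_basis_closedBall.eventually_iff.1 h
    refine ⟨δ, hδ, ⟨2 * ℓ + 2, by positivity⟩, ?_⟩
    rintro ⟨x, lam⟩ hp
    set L : ℝ≥0 := ⟨2 * ℓ + 2, by positivity⟩ with hL
    have hL0 : (L : ℝ≥0∞) ≠ 0 := by
      rw [ENNReal.coe_ne_zero, Ne, ← NNReal.coe_eq_zero]
      change (2 * ℓ + 2 : ℝ) ≠ 0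
      positivity
    have hLv : (L : ℝ) = 2 * ℓ + 2 := rfl
    simp only [Metric.mem_closedBall, Prod.dist_eq, max_le_iff] at hp
    rw [mul_comm, ← ENNReal.div_le_iff hL0 ENNReal.coe_ne_top, ← tsub_le_iff_left,
      Metric.le_infEDist]
    intro z hz
    rw [tsub_le_iff_left, ENNReal.div_le_iff hL0 ENNReal.coe_ne_top, mul_comm]
    -- the residual bound applies to the perturbation `w = z - Φ x` if it is shorter than `δ`;
    -- otherwise the left-hand side is at most `2 δ`, which accounts for the summand `2` in `L`
    obtain ⟨μ, hμ, hle⟩ : ∃ μ ∈ multipliers f Φ Θ xbar,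
        ‖x - xbar‖ + ‖lam - μ‖ ≤ L * (‖Psi f Φ x lam‖ + ‖z - Φ x‖) := by
      rw [hLv]
      have n1 := norm_nonneg (Psi f Φ x lam)
      have n2 := norm_nonneg (z - Φ x)
      by_cases hzδ : ‖z - Φ x‖ ≤ δ
      · obtain ⟨h1, μ, hμ, h2⟩ := hb (x := (x, lam, z - Φ x))
          (by simpa [Prod.dist_eq] using ⟨hp.1, hp.2, hzδ⟩) (by simpa [normalConeInv] using hz)
        refine ⟨μ, hμ, ?_⟩
        simp only at h1 h2
        nlinarith
      · refine ⟨lbar, hsol, ?_⟩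
        rw [← dist_eq_norm, ← dist_eq_norm]
        have : 0 ≤ 2 * ℓ * (‖Psi f Φ x lam‖ + ‖z - Φ x‖) := by positivity
        linarith [hp.1, hp.2]
    calc ‖x - xbar‖ₑ + Metric.infEDist lam (multipliers f Φ Θ xbar)
        ≤ ‖x - xbar‖ₑ + ‖lam - μ‖ₑ := by
          gcongr
          rw [← edist_eq_enorm_sub]
          exact Metric.infEDist_le_edist_of_mem hμ
      _ = ENNReal.ofReal (‖x - xbar‖ + ‖lam - μ‖) := by
          rw [ENNReal.ofReal_add (norm_nonneg _) (norm_nonneg _), ofReal_norm, ofReal_norm]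
      _ ≤ ENNReal.ofReal (L * (‖Psi f Φ x lam‖ + ‖z - Φ x‖)) := ENNReal.ofReal_le_ofReal hle
      _ = L * (‖Psi f Φ x lam‖ₑ + edist (Φ x) z) := by
          rw [ENNReal.ofReal_mul L.coe_nonneg, ENNReal.ofReal_add (norm_nonneg _) (norm_nonneg _),
            ENNReal.ofReal_coe_nnreal, ofReal_norm, ofReal_norm, edist_comm, edist_eq_enorm_sub]

theorem hasFDerivAt_Psi (hf : Differentiable ℝ f) (hΦ2 : Differentiable ℝ (fderiv ℝ Φ))
    (x : X) (lam : Y) :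
    HasFDerivAt (fun y => Psi f Φ y lam) (fderiv ℝ (fun y => Psi f Φ y lam) x) x := by
  refine DifferentiableAt.hasFDerivAt ?_
  simp only [Psi_eq]
  refine (hf x).add ?_
  have h1 : DifferentiableAt ℝ (fun y => ContinuousLinearMap.adjoint (fderiv ℝ Φ y)) x :=
    (ContinuousLinearMap.adjoint (𝕜 := ℝ) (E := X) (F := Y)).toContinuousLinearEquiv
      |>.toContinuousLinearMap.differentiableAt.comp x (hΦ2 x)
  exact h1.clm_apply (differentiableAt_const lam)

/-- The perturbation of the system along a tangent direction `(∇Φ(xbar) ξ, η)` of the graph of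
`N_Θ` that annihilates the linearized equation is of size `o(t)`, whereas `x` moves by `t ‖ξ‖`. -/
theorem HasResidualBound.isNoncritical (hf : Differentiable ℝ f) (hΦ : Differentiable ℝ Φ)
    (hΦ2 : Differentiable ℝ (fderiv ℝ Φ)) (hsol : IsKKTSolution f Φ Θ xbar lbar)
    (h : HasResidualBound f Φ Θ xbar lbar) : IsNoncritical f Φ Θ xbar lbar := by
  rintro ξ ⟨η, hη, hzero⟩
  by_contra hξ
  obtain ⟨t, u, e, ht, ht0, hu, he, hmem⟩ : ∃ (t : ℕ → ℝ) (u e : ℕ → Y), (∀ᶠ k in atTop, 0 < t k) ∧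
      Tendsto t atTop (𝓝 0) ∧ Tendsto u atTop (𝓝 (fderiv ℝ Φ xbar ξ)) ∧ Tendsto e atTop (𝓝 η) ∧
      ∀ᶠ k in atTop, lbar + t k • e k ∈ normalCone Θ (Φ xbar + t k • u k) := by
    by_cases h0 : (fderiv ℝ Φ xbar ξ, η) = 0
    · obtain ⟨h1, h2⟩ := Prod.mk_eq_zero.1 h0
      rw [h1, h2]
      exact ⟨fun k => 1 / ((k : ℝ) + 1), 0, 0, .of_forall fun k => by positivity,
        tendsto_one_div_add_atTop_nhds_zero_nat, tendsto_const_nhds, tendsto_const_nhds,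
        .of_forall fun k => by simpa using hsol.2⟩
    · obtain ⟨t, w, ht, ht0, hw, hmem⟩ := exists_seq_of_mem_posTangentConeAt h0 hη
      rw [nhds_prod_eq] at hw
      exact ⟨t, fun k => (w k).1, fun k => (w k).2, ht, ht0, tendsto_fst.comp hw,
        tendsto_snd.comp hw, hmem⟩
  obtain ⟨ℓ, hℓ, hbd⟩ := h
  set x : ℕ → X := fun k => xbar + t k • ξ with hx
  set lam : ℕ → Y := fun k => lbar + t k • e k with hlam
  set w : ℕ → Y := fun k => Φ xbar + t k • u k - Φ (x k) with hw
  have hxt : Tendsto x atTop (𝓝 xbar) := by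
    simpa using tendsto_const_nhds.add (ht0.smul_const ξ)
  have hlt : Tendsto lam atTop (𝓝 lbar) := by
    simpa using tendsto_const_nhds.add (ht0.smul he)
  have hwt : Tendsto w atTop (𝓝 0) := by
    have : Tendsto w atTop (𝓝 (Φ xbar + (0 : ℝ) • fderiv ℝ Φ xbar ξ - Φ xbar)) :=
      (tendsto_const_nhds.add (ht0.smul hu)).sub ((hΦ.continuous.tendsto _).comp hxt)
    simpa using this
  have hw' : Tendsto (fun k => (t k)⁻¹ • w k) atTop (𝓝 0) := by
    have := hu.sub (tendsto_inv_smul_sub (hΦ xbar).hasFDerivAt ht ht0 (tendsto_const_nhds (x := ξ)))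
    rw [sub_self] at this
    refine this.congr' ?_
    filter_upwards [ht] with k hk
    simp only [hw, hx]
    rw [← sub_sub_sub_cancel_right (Φ xbar + t k • u k) _ (Φ xbar), add_sub_cancel_left,
      smul_sub _ (t k • u k), inv_smul_smul₀ hk.ne']
  have hv' : Tendsto (fun k => (t k)⁻¹ • Psi f Φ (x k) (lam k)) atTop (𝓝 0) := by
    have h1 := tendsto_inv_smul_sub (hasFDerivAt_Psi hf hΦ2 xbar lbar) ht ht0
      (tendsto_const_nhds (x := ξ))
    have h2 : Tendsto (fun k => ContinuousLinearMap.adjoint (fderiv ℝ Φ (x k)) (e k)) atTop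
        (𝓝 (ContinuousLinearMap.adjoint (fderiv ℝ Φ xbar) η)) := by
      have h4 : Tendsto (fun k => ContinuousLinearMap.adjoint (fderiv ℝ Φ (x k))) atTop
          (𝓝 (ContinuousLinearMap.adjoint (fderiv ℝ Φ xbar))) :=
        ((ContinuousLinearMap.adjoint.continuous.comp hΦ2.continuous).tendsto xbar).comp hxt
      exact tendsto_clm_apply h4 he
    have h3 := h1.add h2
    rw [← derivAdj_apply, hzero] at h3
    refine h3.congr' ?_
    filter_upwards [ht] with k hk
    simp only [hlam, hsol.1, sub_zero, Psi_eq, map_add, map_smul]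
    rw [← add_assoc, smul_add _ _ (t k • _), inv_smul_smul₀ hk.ne']
  have hev := (hxt.prodMk_nhds (hlt.prodMk_nhds hwt)).eventually hbd
  have hlim : Tendsto (fun k => ℓ * (‖(t k)⁻¹ • Psi f Φ (x k) (lam k)‖ + ‖(t k)⁻¹ • w k‖)) atTop
      (𝓝 (ℓ * (‖(0 : X)‖ + ‖(0 : Y)‖))) := (hv'.norm.add hw'.norm).const_mul ℓ
  have hle : ‖ξ‖ ≤ ℓ * (‖(0 : X)‖ + ‖(0 : Y)‖) := by
    refine ge_of_tendsto hlim ?_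
    filter_upwards [hev, ht, hmem] with k h1 hk hm
    have h2 := (h1 (by simpa [hw, hlam] using hm)).1
    simp only [hx, add_sub_cancel_left] at h2
    rw [norm_smul, Real.norm_of_nonneg hk.le] at h2
    rw [norm_smul, norm_smul, norm_inv, Real.norm_of_nonneg hk.le, ← mul_add, mul_left_comm,
      ← div_eq_inv_mul, le_div_iff₀ hk, mul_comm]
    exact h2
  simp only [norm_zero, add_zero, mul_zero] at hle
  exact hξ (norm_le_zero_iff.1 hle)

end System

/-! ### Normals to a closed convex cone -/

section ConvexCone

variable {E : Type*} [NormedAddCommGroup E] [InnerProductSpace ℝ E]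

theorem isClosed_polarCone (K : Set E) : IsClosed (polarCone K) := by
  have : polarCone K = ⋂ w ∈ K, {v : E | inner ℝ v w ≤ 0} := by
    ext v
    simp [polarCone]
  rw [this]
  exact isClosed_biInter fun w _ => isClosed_le (by fun_prop) continuous_const

variable [FiniteDimensional ℝ E]

/-- Moreau decomposition: `a` is the sum of a point of `C` and of an orthogonal point of the
polar. -/
theorem exists_moreau_decomposition (C : ProperCone ℝ E) (a : E) :
    ∃ p ∈ C, a - p ∈ polarCone (C : Set E) ∧ inner ℝ (a - p) p = 0 := by
  obtain ⟨p, hp, hmin⟩ := exists_norm_eq_iInf_of_complete_convex C.nonempty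
    C.isClosed.isComplete C.convex a
  have h := (norm_eq_iInf_iff_real_inner_le_zero C.convex hp).1 hmin
  have hp' : p ∈ C := hp
  have h0 : inner ℝ (a - p) p = 0 := by
    have h1 := h 0 C.zero_mem
    have h2 := h ((2 : ℝ) • p) (C.smul_mem hp' (by norm_num))
    rw [two_smul, add_sub_cancel_right] at h2
    rw [zero_sub, inner_neg_right] at h1
    linarith
  refine ⟨p, hp, fun w hw => ?_, h0⟩
  have h1 := h w hw
  rw [inner_sub_right] at h1
  linarith

/-- For a closed convex cone `C`, a pair `(q, ν)` with `q ∈ C ∩ μ^⊥`, `ν ∈ (C ∩ μ^⊥)^*` and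
`⟨ν, q⟩ = 0` is tangent to the graph of `N_C` at `(0, μ)`. A curve in the graph with this velocity
is `t ↦ (t p(t), μ + t (q + ν - p(t)))`, where `t p(t)` is the projection of `μ + t (q + ν)`
on `C`. -/
theorem exists_curve_in_graph_of_normals (C : ProperCone ℝ E) {μ q ν : E} (hq : q ∈ C)
    (hμ : μ ∈ polarCone (C : Set E)) (hμq : inner ℝ μ q = 0)
    (hν : ν ∈ polarCone ((C : Set E) ∩ {w | inner ℝ μ w = 0})) (hνq : inner ℝ ν q = 0) :
    ∃ p : ℝ → E, Tendsto p (𝓝[>] 0) (𝓝 q) ∧ ∀ t : ℝ, 0 < t → p t ∈ C ∧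
      μ + t • (q + ν - p t) ∈ polarCone (C : Set E) ∧
      inner ℝ (μ + t • (q + ν - p t)) (p t) = 0 := by
  choose p hpC hpolar horth using fun t : ℝ => exists_moreau_decomposition C (t⁻¹ • μ + (q + ν))
  have hscale : ∀ t : ℝ, 0 < t →
      μ + t • (q + ν - p t) = t • (t⁻¹ • μ + (q + ν) - p t) := by
    intro t ht
    rw [add_sub_assoc (t⁻¹ • μ), smul_add t (t⁻¹ • μ), smul_inv_smul₀ ht.ne']
  have hineq : ∀ t : ℝ, 0 < t →
      -(t⁻¹ * inner ℝ μ (p t)) + ‖p t - q‖ ^ 2 ≤ inner ℝ ν (p t) := by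
    intro t ht
    have h1 := hpolar t q hq
    have h2 := horth t
    rw [← real_inner_self_eq_norm_sq]
    simp only [inner_sub_left, inner_add_left, inner_sub_right, real_inner_smul_left,
      real_inner_comm q (p t)] at h1 h2 ⊢
    rw [hμq, hνq] at h1
    linarith
  have hμp : ∀ t, inner ℝ μ (p t) ≤ 0 := fun t => hμ _ (hpC t)
  have hnorm : ∀ t : ℝ, 0 < t → ‖p t - q‖ ≤ ‖ν‖ := by
    intro t ht
    have h1 := hineq t ht
    have h2 : inner ℝ ν (p t) ≤ ‖ν‖ * ‖p t - q‖ := by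
      have := real_inner_le_norm ν (p t - q)
      rwa [inner_sub_right, hνq, sub_zero] at this
    have h3 : t⁻¹ * inner ℝ μ (p t) ≤ 0 :=
      mul_nonpos_of_nonneg_of_nonpos (inv_pos.2 ht).le (hμp t)
    by_contra! hlt
    nlinarith [norm_nonneg (p t - q), norm_nonneg ν]
  refine ⟨p, ?_, fun t ht => ⟨hpC t, ?_, ?_⟩⟩
  · refine (isCompact_closedBall q ‖ν‖).tendsto_nhds_of_unique_mapClusterPt ?_ ?_
    · filter_upwards [self_mem_nhdsWithin] with t ht
      rw [Metric.mem_closedBall, dist_eq_norm]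
      exact hnorm t ht
    · intro y _ hy
      obtain ⟨U, hU, hlim⟩ := mapClusterPt_iff_ultrafilter.1 hy
      have hpos : ∀ᶠ t : ℝ in (U : Filter ℝ), 0 < t := hU self_mem_nhdsWithin
      have ht0 : Tendsto (fun t : ℝ => t) U (𝓝 0) := hU.trans nhdsWithin_le_nhds
      have hyC : y ∈ C := C.isClosed.mem_of_tendsto hlim (.of_forall hpC)
      have hi : Tendsto (fun t => inner ℝ ν (p t)) U (𝓝 (inner ℝ ν y)) :=
        tendsto_const_nhds.inner hlim
      have hyμ : inner ℝ μ y = 0 := by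
        refine le_antisymm (hμ y hyC) ?_
        have h1 : Tendsto (fun t => inner ℝ μ (p t) + t * inner ℝ ν (p t)) U
            (𝓝 (inner ℝ μ y + 0 * inner ℝ ν y)) :=
          (tendsto_const_nhds.inner hlim).add (ht0.mul hi)
        rw [zero_mul, add_zero] at h1
        refine ge_of_tendsto h1 ?_
        filter_upwards [hpos] with t ht
        have h2 := hineq t ht
        have h3 : -(t⁻¹ * inner ℝ μ (p t)) ≤ inner ℝ ν (p t) := by nlinarith
        have h4 := mul_le_mul_of_nonneg_left h3 ht.le
        rw [mul_neg, mul_inv_cancel_left₀ ht.ne'] at h4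
        linarith
      have h5 : ‖y - q‖ ^ 2 ≤ inner ℝ ν y := by
        refine le_of_tendsto_of_tendsto ((hlim.sub_const q).norm.pow 2) hi ?_
        filter_upwards [hpos] with t ht
        have h2 := hineq t ht
        have h3 : t⁻¹ * inner ℝ μ (p t) ≤ 0 :=
          mul_nonpos_of_nonneg_of_nonpos (inv_pos.2 ht).le (hμp t)
        linarith
      have h6 : inner ℝ ν y ≤ 0 := hν y ⟨hyC, hyμ⟩
      have h7 : ‖y - q‖ = 0 := pow_eq_zero_iff two_ne_zero |>.1 (by nlinarith [sq_nonneg ‖y - q‖])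
      exact sub_eq_zero.1 (norm_eq_zero.1 h7)
  · intro w hw
    rw [hscale t ht, real_inner_smul_left]
    exact mul_nonpos_of_nonneg_of_nonpos ht.le (hpolar t w hw)
  · rw [hscale t ht, real_inner_smul_left, horth, mul_zero]

end ConvexCone

/-! ### Normals to a cone reducible set -/

section LocalReduction

variable {Y E : Type*} [NormedAddCommGroup Y] [InnerProductSpace ℝ Y]
  [NormedAddCommGroup E] [InnerProductSpace ℝ E]

/-- The data of a `C²`-cone reduction of `Θ` near `z`: the reducing map `h`, and right inverses
`S y` of `∇h(y)` that depend continuously on `y`. Since `λ = ∇h(y)^* μ` forces `μ = S(y)^* λ`,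
the latter make the multipliers `μ` of normals `λ ∈ N_Θ(y)` continuous functions of `(y, λ)`. -/
structure LocalReduction (Θ : Set Y) (z : Y) (C : ProperCone ℝ E) (h : Y → E)
    (S : Y → E →L[ℝ] Y) : Prop where
  contDiff : ContDiff ℝ 2 h
  apply_eq_zero : h z = 0
  mem_iff : ∀ᶠ y in 𝓝 z, y ∈ Θ ↔ h y ∈ C
  rightInverse : ∀ᶠ y in 𝓝 z, (fderiv ℝ h y).comp (S y) = .id ℝ E
  continuousAt : ∀ᶠ y in 𝓝 z, ContinuousAt S y

namespace LocalReduction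

variable {Θ : Set Y} {z : Y} {C : ProperCone ℝ E} {h : Y → E} {S : Y → E →L[ℝ] Y}

theorem hasStrictFDerivAt (H : LocalReduction Θ z C h S) (y : Y) :
    HasStrictFDerivAt h (fderiv ℝ h y) y :=
  H.contDiff.contDiffAt.hasStrictFDerivAt (by norm_num)

theorem continuous_fderiv (H : LocalReduction Θ z C h S) : Continuous (fderiv ℝ h) :=
  H.contDiff.continuous_fderiv (by norm_num)

theorem hasFDerivAt_fderiv (H : LocalReduction Θ z C h S) (y : Y) :
    HasFDerivAt (fderiv ℝ h) (fderiv ℝ (fderiv ℝ h) y) y :=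
  ((H.contDiff.fderiv_right (m := 1) (by norm_num)).differentiable (by norm_num) y).hasFDerivAt

end LocalReduction

theorem IsC2ConeReducibleAt.exists_localReduction {Θ : Set Y} {z : Y} {C : ProperCone ℝ E}
    [FiniteDimensional ℝ E] (H : IsC2ConeReducibleAt Θ z C) :
    ∃ (h : Y → E) (S : Y → E →L[ℝ] Y), LocalReduction Θ z C h S := by
  obtain ⟨-, O, hO, h, hC2, hΘ, hz, hsurj⟩ := H
  obtain ⟨R, hR⟩ := (fderiv ℝ h z).exists_rightInverse_of_surjective
    (LinearMap.range_eq_top.2 hsurj)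
  have hcont : Continuous fun y => (fderiv ℝ h y).comp R :=
    (hC2.continuous_fderiv (by norm_num)).clm_comp continuous_const
  have hunit : ∀ᶠ y in 𝓝 z, IsUnit ((fderiv ℝ h y).comp R) := by
    refine hcont.continuousAt.eventually_mem (Units.isOpen.mem_nhds ?_)
    rw [hR]
    exact isUnit_one
  refine ⟨h, fun y => R.comp (Ring.inverse ((fderiv ℝ h y).comp R)), hC2, hz, ?_, ?_, ?_⟩
  · filter_upwards [hO] with y hy
    constructor
    · intro h1
      have : y ∈ Θ ∩ O := ⟨h1, hy⟩
      rw [hΘ] at this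
      exact this.2
    · intro h1
      have : y ∈ {y | y ∈ O ∧ h y ∈ C} := ⟨hy, h1⟩
      rw [← hΘ] at this
      exact this.1
  · filter_upwards [hunit] with y hy
    rw [← ContinuousLinearMap.comp_assoc]
    exact Ring.mul_inverse_cancel _ hy
  · filter_upwards [hunit] with y hy
    obtain ⟨v, hv⟩ := hy
    have h1 : ContinuousAt Ring.inverse ((fderiv ℝ h y).comp R) := by
      rw [← hv]
      exact NormedRing.inverse_continuousAt v
    exact continuousAt_const.clm_comp (ContinuousAt.comp (f := fun y => (fderiv ℝ h y).comp R)
      h1 hcont.continuousAt)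

end LocalReduction

section Reducible

variable {Y E : Type*} [NormedAddCommGroup Y] [InnerProductSpace ℝ Y] [FiniteDimensional ℝ Y]
  [NormedAddCommGroup E] [InnerProductSpace ℝ E]

/-- Curves lift along a submersion: if `e → A d`, then there are `d' → d` such that `h` moves from
`h y` by `t e` when `y` moves by `t d'`. -/
theorem exists_lift_of_hasStrictFDerivAt {h : Y → E} {y : Y} {A : Y →L[ℝ] E} {R : E →L[ℝ] Y}
    (hR : A.comp R = .id ℝ E) (hh : HasStrictFDerivAt h A y) {ι : Type*} {l : Filter ι}
    {t : ι → ℝ} (ht : ∀ᶠ k in l, 0 < t k) (ht0 : Tendsto t l (𝓝 0)) {e : ι → E} {d : Y}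
    (he : Tendsto e l (𝓝 (A d))) :
    ∃ d' : ι → Y, Tendsto d' l (𝓝 d) ∧ ∀ᶠ k in l, h (y + t k • d' k) = h y + t k • e k := by
  have hAR : ∀ v, A (R v) = v := fun v => congrArg (fun B : E →L[ℝ] E => B v) hR
  -- in the coordinates `G`, which are tangent to the identity at `y`, the map `h` is affine
  set G : Y → Y := fun z => R (h z - h y) + ((z - y) - R (A (z - y))) with hG
  have hGd : HasStrictFDerivAt G ((ContinuousLinearEquiv.refl ℝ Y : Y ≃L[ℝ] Y) : Y →L[ℝ] Y) y := by
    have h1 : HasStrictFDerivAt G (R.comp A + (.id ℝ Y - (R.comp A).comp (.id ℝ Y))) y := by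
      have hid : HasStrictFDerivAt (fun z : Y => z - y) (.id ℝ Y) y :=
        (hasStrictFDerivAt_id y).sub_const y
      exact (R.hasStrictFDerivAt.comp y (hh.sub_const (h y))).add
        (hid.sub ((R.comp A).hasStrictFDerivAt.comp y hid))
    convert h1 using 1
    ext v
    simp
  have hGy : G y = 0 := by simp [hG]
  have hAG : ∀ z, A (G z) = h z - h y := by
    intro z
    simp [hG, hAR]
  set g := hGd.localInverse G _ y with hg
  have hgd : HasFDerivAt g (.id ℝ Y) 0 := by
    have := hGd.to_localInverse.hasFDerivAt
    rw [hGy] at this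
    exact this
  have hg0 : g 0 = y := by
    have := hGd.localInverse_apply_image
    rwa [hGy] at this
  have hright : ∀ᶠ v in 𝓝 (0 : Y), G (g v) = v := by
    have := hGd.eventually_right_inverse
    rwa [hGy] at this
  set v : ι → Y := fun k => d + R (e k - A d) with hv
  have hvt : Tendsto v l (𝓝 d) := by
    have : Tendsto v l (𝓝 (d + R (A d - A d))) :=
      tendsto_const_nhds.add ((R.continuous.tendsto _).comp (he.sub_const _))
    simpa using this
  refine ⟨fun k => (t k)⁻¹ • (g (0 + t k • v k) - g 0), ?_, ?_⟩
  · simpa using tendsto_inv_smul_sub hgd ht ht0 hvt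
  · have htv : Tendsto (fun k => t k • v k) l (𝓝 0) := by simpa using ht0.smul hvt
    filter_upwards [ht, htv.eventually hright] with k hk hGk
    rw [smul_inv_smul₀ hk.ne', hg0, zero_add, add_sub_cancel, ← sub_eq_iff_eq_add', ← hAG, hGk]
    simp [hv, hAR, -smul_add]

theorem LocalReduction.mem_posTangentConeAt_iff {Θ : Set Y} {z : Y} {C : ProperCone ℝ E}
    {h : Y → E} {S : Y → E →L[ℝ] Y} (H : LocalReduction Θ z C h S) {w : Y} :
    w ∈ posTangentConeAt Θ z ↔ fderiv ℝ h z w ∈ C := by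
  have hzΘ : z ∈ Θ := by
    rw [H.mem_iff.self_of_nhds, H.apply_eq_zero]
    exact C.zero_mem
  constructor
  · intro hw
    obtain ⟨t, u, ht, ht0, hu, hmem⟩ := (mem_posTangentConeAt_iff_seq hzΘ).1 hw
    have h1 := tendsto_inv_smul_sub (H.hasStrictFDerivAt z).hasFDerivAt (.of_forall ht) ht0 hu
    have hzt : Tendsto (fun k => z + t k • u k) atTop (𝓝 z) := by
      simpa using tendsto_const_nhds.add (ht0.smul hu)
    refine C.isClosed.mem_of_tendsto h1 ?_
    filter_upwards [hzt.eventually H.mem_iff] with k hk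
    rw [H.apply_eq_zero, sub_zero]
    exact C.smul_mem (hk.1 (hmem k)) (inv_pos.2 (ht k)).le
  · intro hw
    have ht0 : Tendsto (fun t : ℝ => t) (𝓝[>] 0) (𝓝 0) := nhdsWithin_le_nhds
    obtain ⟨d', hd', hlift⟩ := exists_lift_of_hasStrictFDerivAt H.rightInverse.self_of_nhds
      (H.hasStrictFDerivAt z) (l := 𝓝[>] (0 : ℝ)) (t := fun t => t) self_mem_nhdsWithin ht0
      (e := fun _ => fderiv ℝ h z w) tendsto_const_nhds
    have hzt : Tendsto (fun t : ℝ => z + t • d' t) (𝓝[>] 0) (𝓝 z) := by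
      simpa using tendsto_const_nhds.add (ht0.smul hd')
    refine mem_posTangentConeAt_of_tendsto (l := 𝓝[>] (0 : ℝ)) (t := fun t => t)
      self_mem_nhdsWithin ht0 hd' ?_
    filter_upwards [hlift, hzt.eventually H.mem_iff, self_mem_nhdsWithin] with t h2 h3 (h4 : 0 < t)
    rw [h3, h2, H.apply_eq_zero, zero_add]
    exact C.smul_mem hw h4.le

theorem LocalReduction.mem_criticalCone_iff {Θ : Set Y} {z : Y} {C : ProperCone ℝ E}
    {h : Y → E} {S : Y → E →L[ℝ] Y} (H : LocalReduction Θ z C h S) {lam w : Y} :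
    w ∈ criticalCone Θ z lam ↔ fderiv ℝ h z w ∈ C ∧ inner ℝ lam w = 0 := by
  rw [criticalCone, mem_inter_iff, H.mem_posTangentConeAt_iff]
  rfl

variable [FiniteDimensional ℝ E]

/-- A functional that is nonpositive, hence zero, on `ker A` is of the form `A^* μ`; the right
inverse `R` of `A` gives `μ = R^* lam`. -/
theorem adjoint_comp_adjoint_apply_eq {A : Y →L[ℝ] E} {R : E →L[ℝ] Y}
    (hR : A.comp R = .id ℝ E) {lam : Y} (h : ∀ v, A v = 0 → inner ℝ lam v ≤ 0) :
    ContinuousLinearMap.adjoint A (ContinuousLinearMap.adjoint R lam) = lam := by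
  have hAR : ∀ v, A (R v) = v := fun v => congrArg (fun B : E →L[ℝ] E => B v) hR
  refine ext_inner_right ℝ fun v => ?_
  rw [ContinuousLinearMap.adjoint_inner_left, ContinuousLinearMap.adjoint_inner_left]
  have h1 := h (R (A v) - v) (by simp [hAR])
  have h2 := h (v - R (A v)) (by simp [hAR])
  rw [inner_sub_right] at h1 h2
  linarith

theorem adjoint_comp_adjoint_of_rightInverse {A : Y →L[ℝ] E} {R : E →L[ℝ] Y}
    (hR : A.comp R = .id ℝ E) (μ : E) :
    ContinuousLinearMap.adjoint R (ContinuousLinearMap.adjoint A μ) = μ := by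
  have hAR : ∀ v, A (R v) = v := fun v => congrArg (fun B : E →L[ℝ] E => B v) hR
  refine ext_inner_right ℝ fun v => ?_
  rw [ContinuousLinearMap.adjoint_inner_left, ContinuousLinearMap.adjoint_inner_left, hAR]

/-- Where `Θ` is the preimage of a cone `C` under a submersion `h`, every regular normal is the
image under `∇h(y)^*` of a normal to `C` at `h y`. -/
theorem regularNormalCone_subset_of_eventually_iff {Θ : Set Y} {C : ProperCone ℝ E} {h : Y → E}
    {y : Y} {A : Y →L[ℝ] E} {R : E →L[ℝ] Y} (hR : A.comp R = .id ℝ E)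
    (hh : HasStrictFDerivAt h A y) (hΘ : ∀ᶠ z in 𝓝 y, z ∈ Θ ↔ h z ∈ C) {lam : Y}
    (hlam : lam ∈ regularNormalCone Θ y) :
    ContinuousLinearMap.adjoint R lam ∈ polarCone (C : Set E) ∧
      inner ℝ (ContinuousLinearMap.adjoint R lam) (h y) = 0 ∧
      ContinuousLinearMap.adjoint A (ContinuousLinearMap.adjoint R lam) = lam := by
  have hAR : ∀ v, A (R v) = v := fun v => congrArg (fun B : E →L[ℝ] E => B v) hR
  have hy : h y ∈ C := hΘ.self_of_nhds.1 hlam.1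
  -- every `d` with `h y + A d ∈ C` is a tangent direction, so `lam` is nonpositive on it
  have key : ∀ d : Y, h y + A d ∈ C → inner ℝ lam d ≤ 0 := by
    intro d hd
    obtain ⟨d', hd', hlift⟩ := exists_lift_of_hasStrictFDerivAt hR hh
      (l := 𝓝[>] (0 : ℝ)) (t := fun t => t) self_mem_nhdsWithin nhdsWithin_le_nhds
      (e := fun _ => A d) tendsto_const_nhds
    have ht0 : Tendsto (fun t : ℝ => t) (𝓝[>] 0) (𝓝 0) := nhdsWithin_le_nhds
    have hyt : Tendsto (fun t : ℝ => y + t • d' t) (𝓝[>] 0) (𝓝 y) := by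
      simpa using tendsto_const_nhds.add (ht0.smul hd')
    have hmem : ∀ᶠ t in 𝓝[>] (0 : ℝ), y + t • d' t ∈ Θ := by
      have h1 : ∀ᶠ t in 𝓝[>] (0 : ℝ), t < 1 := ht0.eventually_lt_const one_pos
      filter_upwards [hlift, hyt.eventually hΘ, h1, self_mem_nhdsWithin] with t h2 h3 h4 h5
      rw [h3, h2]
      have h6 : h y + t • A d = (1 - t) • h y + t • (h y + A d) := by module
      rw [h6]
      exact C.add_mem (C.smul_mem hy (by linarith)) (C.smul_mem hd (le_of_lt h5))
    have hin : ∀ ε : ℝ, 0 < ε → inner ℝ lam d ≤ ε * ‖d‖ := by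
      intro ε hε
      have h1 := (tendsto_nhdsWithin_iff.2 ⟨hyt, hmem⟩).eventually (hlam.2 ε hε)
      refine le_of_tendsto_of_tendsto (tendsto_const_nhds.inner hd') (hd'.norm.const_mul ε) ?_
      filter_upwards [h1, self_mem_nhdsWithin] with t h2 (h3 : 0 < t)
      rw [add_sub_cancel_left, real_inner_smul_right, norm_smul, Real.norm_of_nonneg h3.le,
        mul_left_comm] at h2
      exact le_of_mul_le_mul_left h2 h3
    have hlim : Tendsto (fun ε : ℝ => ε * ‖d‖) (𝓝[>] 0) (𝓝 (0 * ‖d‖)) := ht0.mul_const _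
    rw [zero_mul] at hlim
    exact ge_of_tendsto hlim (by filter_upwards [self_mem_nhdsWithin] with ε hε using hin ε hε)
  have hpol : ∀ c ∈ C, inner ℝ (ContinuousLinearMap.adjoint R lam) c ≤ 0 := by
    intro c hc
    rw [ContinuousLinearMap.adjoint_inner_left]
    exact key _ (by rw [hAR]; exact C.add_mem hy hc)
  refine ⟨hpol, le_antisymm (hpol _ hy) ?_, adjoint_comp_adjoint_apply_eq hR fun v hv =>
    key v (by rwa [hv, add_zero])⟩
  have := key (R (-h y)) (by rw [hAR, add_neg_cancel]; exact C.zero_mem)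
  rw [map_neg, inner_neg_right] at this
  rw [ContinuousLinearMap.adjoint_inner_left]
  linarith

theorem adjoint_apply_mem_regularNormalCone {Θ : Set Y} {C : ProperCone ℝ E} {h : Y → E}
    {y : Y} {A : Y →L[ℝ] E} (hh : HasFDerivAt h A y) (hΘ : ∀ᶠ z in 𝓝 y, z ∈ Θ ↔ h z ∈ C)
    (hy : h y ∈ C) {μ : E} (hμ : μ ∈ polarCone (C : Set E)) (hμy : inner ℝ μ (h y) = 0) :
    ContinuousLinearMap.adjoint A μ ∈ regularNormalCone Θ y := by
  refine ⟨hΘ.self_of_nhds.2 hy, fun ε hε => ?_⟩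
  have hδ : 0 < ε / (‖μ‖ + 1) := by positivity
  have h1 := hh.isLittleO.def hδ
  filter_upwards [mem_nhdsWithin_of_mem_nhds h1, mem_nhdsWithin_of_mem_nhds hΘ,
    self_mem_nhdsWithin] with z h2 h3 h4
  have h5 : inner ℝ μ (h z) ≤ 0 := hμ _ (h3.1 h4)
  have h6 := real_inner_le_norm μ (-(h z - h y - A (z - y)))
  rw [norm_neg, inner_neg_right, inner_sub_right, inner_sub_right, hμy] at h6
  rw [ContinuousLinearMap.adjoint_inner_left]
  have h7 : ‖μ‖ * ‖h z - h y - A (z - y)‖ ≤ ε * ‖z - y‖ := by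
    calc ‖μ‖ * ‖h z - h y - A (z - y)‖ ≤ (‖μ‖ + 1) * (ε / (‖μ‖ + 1) * ‖z - y‖) := by
          gcongr
          linarith
      _ = ε * ‖z - y‖ := by field_simp
  linarith

namespace LocalReduction

variable {Θ : Set Y} {z : Y} {C : ProperCone ℝ E} {h : Y → E} {S : Y → E →L[ℝ] Y}

/-- The limiting normals to `Θ` near `z` are the vectors `∇h(y)^* μ` with `μ ∈ N_C(h(y))`; here
`μ = S(y)^* λ`. -/
theorem eventually_normalCone (H : LocalReduction Θ z C h S) :
    ∀ᶠ y in 𝓝 z, ∀ lam ∈ normalCone Θ y,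
      ContinuousLinearMap.adjoint (S y) lam ∈ polarCone (C : Set E) ∧
      inner ℝ (ContinuousLinearMap.adjoint (S y) lam) (h y) = 0 ∧
      ContinuousLinearMap.adjoint (fderiv ℝ h y) (ContinuousLinearMap.adjoint (S y) lam) = lam := by
  filter_upwards [H.continuousAt, H.mem_iff.eventually_nhds, H.rightInverse.eventually_nhds] with
    y hS hmem hR
  rintro lam ⟨-, yk, uk, hyk, huk, hN⟩
  have hSk : Tendsto (fun k => ContinuousLinearMap.adjoint (S (yk k))) atTop
      (𝓝 (ContinuousLinearMap.adjoint (S y))) :=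
    (ContinuousLinearMap.adjoint.continuous.tendsto _).comp (hS.tendsto.comp hyk)
  have hAk : Tendsto (fun k => ContinuousLinearMap.adjoint (fderiv ℝ h (yk k))) atTop
      (𝓝 (ContinuousLinearMap.adjoint (fderiv ℝ h y))) :=
    (ContinuousLinearMap.adjoint.continuous.tendsto _).comp
      ((H.continuous_fderiv.tendsto y).comp hyk)
  have hμk := tendsto_clm_apply hSk huk
  have hev : ∀ᶠ k in atTop,
      ContinuousLinearMap.adjoint (S (yk k)) (uk k) ∈ polarCone (C : Set E) ∧
      inner ℝ (ContinuousLinearMap.adjoint (S (yk k)) (uk k)) (h (yk k)) = 0 ∧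
      ContinuousLinearMap.adjoint (fderiv ℝ h (yk k))
        (ContinuousLinearMap.adjoint (S (yk k)) (uk k)) = uk k := by
    filter_upwards [hyk.eventually hmem.eventually_nhds, hyk.eventually hR] with k h1 h2
    exact regularNormalCone_subset_of_eventually_iff h2 (H.hasStrictFDerivAt _)
      h1 (hN k)
  refine ⟨(isClosed_polarCone _).mem_of_tendsto hμk (hev.mono fun k hk => hk.1), ?_, ?_⟩
  · refine tendsto_nhds_unique (hμk.inner ((H.contDiff.continuous.tendsto y).comp hyk)) ?_
    exact tendsto_const_nhds.congr' (hev.mono fun k hk => hk.2.1.symm)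
  · refine tendsto_nhds_unique (tendsto_clm_apply hAk hμk) ?_
    exact huk.congr' (hev.mono fun k hk => hk.2.2.symm)

/-- For a `C²`-cone reducible set, `DN_Θ(z, lam)(u)` contains the curvature term
`∇²⟨μ, h⟩(z) u` plus every normal `η` to the critical cone at `u`, where `lam = ∇h(z)^* μ`. -/
theorem mem_graphicalDeriv_normalCone (H : LocalReduction Θ z C h S) {lam u η : Y}
    (hlam : lam ∈ normalCone Θ z) (hu : u ∈ criticalCone Θ z lam)
    (hη : η ∈ polarCone (criticalCone Θ z lam)) (hηu : inner ℝ η u = 0) :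
    ContinuousLinearMap.adjoint (fderiv ℝ (fderiv ℝ h) z u) (ContinuousLinearMap.adjoint (S z) lam)
      + η ∈ graphicalDeriv (normalCone Θ) z lam u := by
  set A := fderiv ℝ h z with hA
  set μ := ContinuousLinearMap.adjoint (S z) lam with hμdef
  set ν := ContinuousLinearMap.adjoint (S z) η with hνdef
  have hR : A.comp (S z) = .id ℝ E := H.rightInverse.self_of_nhds
  have hAR : ∀ v, A (S z v) = v := fun v => congrArg (fun B : E →L[ℝ] E => B v) hR
  obtain ⟨hμC, -, hAμ⟩ := H.eventually_normalCone.self_of_nhds lam hlam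
  have hlv : ∀ v, inner ℝ lam v = inner ℝ μ (A v) := by
    intro v
    rw [← ContinuousLinearMap.adjoint_inner_left, hAμ]
  obtain ⟨huC, hlu⟩ := H.mem_criticalCone_iff.1 hu
  have hAν : ContinuousLinearMap.adjoint A ν = η := by
    refine adjoint_comp_adjoint_apply_eq hR fun v hv => hη v (H.mem_criticalCone_iff.2 ⟨?_, ?_⟩)
    · rw [← hA, hv]
      exact C.zero_mem
    · rw [hlv, hv, inner_zero_right]
  obtain ⟨p, hp, hpt⟩ := exists_curve_in_graph_of_normals C (μ := μ) (q := A u) (ν := ν) huC hμC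
    (by rw [← hlv, hlu])
    (by
      rintro c ⟨hc, hcμ⟩
      rw [hνdef, ContinuousLinearMap.adjoint_inner_left]
      refine hη _ (H.mem_criticalCone_iff.2 ⟨?_, ?_⟩)
      · rw [← hA, hAR]
        exact hc
      · rw [hlv, hAR]
        exact hcμ)
    (by rw [← ContinuousLinearMap.adjoint_inner_left, hAν, hηu])
  have hpos : ∀ᶠ t in 𝓝[>] (0 : ℝ), 0 < t := self_mem_nhdsWithin
  have ht0 : Tendsto (fun t : ℝ => t) (𝓝[>] 0) (𝓝 0) := nhdsWithin_le_nhds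
  obtain ⟨d, hd, hlift⟩ := exists_lift_of_hasStrictFDerivAt hR (H.hasStrictFDerivAt z) hpos ht0 hp
  set y : ℝ → Y := fun t => z + t • d t with hy
  have hyt : Tendsto y (𝓝[>] 0) (𝓝 z) := by
    simpa using tendsto_const_nhds.add (ht0.smul hd)
  set n : ℝ → E := fun t => μ + t • (A u + ν - p t) with hn
  have hnt : Tendsto n (𝓝[>] 0) (𝓝 μ) := by
    simpa using tendsto_const_nhds.add (ht0.smul (tendsto_const_nhds.sub hp))
  have hquot : Tendsto (fun t => ContinuousLinearMap.adjoint
      (t⁻¹ • (fderiv ℝ h (z + t • d t) - fderiv ℝ h z)) (n t) +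
      ContinuousLinearMap.adjoint A (A u + ν - p t)) (𝓝[>] 0)
      (𝓝 (ContinuousLinearMap.adjoint (fderiv ℝ (fderiv ℝ h) z u) μ + η)) := by
    have h1 := tendsto_inv_smul_sub (H.hasFDerivAt_fderiv z) hpos ht0 hd
    have h2 : Tendsto (fun t => ContinuousLinearMap.adjoint
        (t⁻¹ • (fderiv ℝ h (z + t • d t) - fderiv ℝ h z))) (𝓝[>] 0)
        (𝓝 (ContinuousLinearMap.adjoint (fderiv ℝ (fderiv ℝ h) z u))) :=
      (ContinuousLinearMap.adjoint.continuous.tendsto _).comp h1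
    have h3 : Tendsto (fun t => A u + ν - p t) (𝓝[>] 0) (𝓝 (A u + ν - A u)) :=
      tendsto_const_nhds.sub hp
    rw [add_sub_cancel_left] at h3
    rw [← hAν]
    exact (tendsto_clm_apply h2 hnt).add
      (((ContinuousLinearMap.adjoint A).continuous.tendsto _).comp h3)
  refine mem_posTangentConeAt_of_tendsto (l := 𝓝[>] (0 : ℝ)) hpos ht0 (hd.prodMk_nhds hquot) ?_
  filter_upwards [hlift, hpos, hyt.eventually H.mem_iff.eventually_nhds] with t h1 h2 h3
  obtain ⟨hpC, hnC, hnp⟩ := hpt t h2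
  rw [H.apply_eq_zero, zero_add] at h1
  have hN : ContinuousLinearMap.adjoint (fderiv ℝ h (y t)) (n t) ∈ normalCone Θ (y t) := by
    refine regularNormalCone_subset_normalCone _ _ (adjoint_apply_mem_regularNormalCone
      (H.hasStrictFDerivAt _).hasFDerivAt h3 ?_ hnC ?_)
    · rw [h1]
      exact C.smul_mem hpC h2.le
    · rw [h1, real_inner_smul_right, hnp, mul_zero]
  have heq : lam + t • (ContinuousLinearMap.adjoint
      (t⁻¹ • (fderiv ℝ h (z + t • d t) - fderiv ℝ h z)) (n t) +
      ContinuousLinearMap.adjoint A (A u + ν - p t)) =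
      ContinuousLinearMap.adjoint (fderiv ℝ h (y t)) (n t) := by
    rw [smul_add, ← smul_apply, ← map_smul ContinuousLinearMap.adjoint,
      smul_inv_smul₀ h2.ne', ← map_smul, map_sub, sub_apply,
      ← sub_eq_zero]
    have h5 : t • (A u + ν - p t) = n t - μ := by simp [hn]
    rw [h5, map_sub, hAμ]
    abel
  change lam + t • _ ∈ normalCone Θ (z + t • d t)
  rw [heq]
  exact hN

end LocalReduction

end Reducible

/-! ### Calm multipliers and noncriticality -/

section Calm

variable {X Y : Type*} [NormedAddCommGroup X] [InnerProductSpace ℝ X] [FiniteDimensional ℝ X]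
  [NormedAddCommGroup Y] [InnerProductSpace ℝ Y] [FiniteDimensional ℝ Y]
  {f : X → X} {Φ : X → Y} {Θ : Set Y} {xbar : X} {lbar : Y}

theorem _root_.HasFDerivAt.eventually_norm_sub_le {E F : Type*} [NormedAddCommGroup E]
    [NormedSpace ℝ E] [NormedAddCommGroup F] [NormedSpace ℝ F] {g : E → F} {g' : E →L[ℝ] F} {a : E}
    (hg : HasFDerivAt g g' a) : ∃ L : ℝ, 0 ≤ L ∧ ∀ᶠ x in 𝓝 a, ‖g x - g a‖ ≤ L * ‖x - a‖ := by
  obtain ⟨L, hL, h⟩ := hg.isBigO_sub.exists_nonneg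
  exact ⟨L, hL, h.bound⟩

/-- A solution `(x, lam)` of the system perturbed by `(v, w)` solves, with `x` replaced by `xbar`,
the system with a perturbation of size `O(‖x - xbar‖ + ‖v‖ + ‖w‖)`; so calmness of the multiplier
mapping bounds the distance of `lam` to the multipliers of `xbar`. -/
theorem exists_multiplier_of_isCalmAt (hf : Differentiable ℝ f) (hΦ : Differentiable ℝ Φ)
    (hΦ2 : Differentiable ℝ (fderiv ℝ Φ)) (hsol : IsKKTSolution f Φ Θ xbar lbar)
    (hcalm : IsCalmAt (multiplierMap f Φ Θ xbar) (0, 0) lbar) :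
    ∃ κ : ℝ, 0 ≤ κ ∧ ∀ᶠ p : X × Y × Y in 𝓝 (xbar, lbar, 0),
      p.2.1 ∈ normalCone Θ (Φ p.1 + p.2.2) → ∃ μ ∈ multipliers f Φ Θ xbar,
        ‖p.2.1 - μ‖ ≤ κ * (‖p.1 - xbar‖ + (‖Psi f Φ p.1 p.2.1‖ + ‖p.2.2‖)) := by
  obtain ⟨ℓ, hℓ, U, hU, V, hV, hUV⟩ := hcalm
  obtain ⟨L₁, hL₁, h₁⟩ := (hf xbar).hasFDerivAt.eventually_norm_sub_le
  obtain ⟨L₂, hL₂, h₂⟩ := (hΦ xbar).hasFDerivAt.eventually_norm_sub_le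
  obtain ⟨L₃, hL₃, h₃⟩ := (hΦ2 xbar).hasFDerivAt.eventually_norm_sub_le
  have hfst : Tendsto (fun p : X × Y × Y => p.1) (𝓝 (xbar, lbar, 0)) (𝓝 xbar) :=
    continuous_fst.tendsto _
  have hlam : Tendsto (fun p : X × Y × Y => p.2.1) (𝓝 (xbar, lbar, 0)) (𝓝 lbar) :=
    (continuous_fst.comp continuous_snd).tendsto _
  have hpert : Tendsto (fun p : X × Y × Y => (Psi f Φ xbar p.2.1, Φ p.1 + p.2.2 - Φ xbar))
      (𝓝 (xbar, lbar, 0)) (𝓝 (0, 0)) := by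
    refine Tendsto.prodMk_nhds ?_ ?_
    · have h := (continuous_Psi hf hΦ2).tendsto (xbar, lbar)
      simp only [hsol.1] at h
      exact h.comp (tendsto_const_nhds.prodMk_nhds hlam)
    · have h : Continuous fun p : X × Y × Y => Φ p.1 + p.2.2 - Φ xbar := by
        have := hΦ.continuous
        fun_prop
      simpa using h.tendsto (xbar, lbar, (0 : Y))
  have hbdd : ∀ᶠ p : X × Y × Y in 𝓝 (xbar, lbar, 0), ‖p.2.1‖ ≤ ‖lbar‖ + 1 :=
    (hlam.norm.eventually_lt_const (lt_add_one _)).mono fun p hp => hp.le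
  set K : ℝ := 1 + L₁ + L₂ + L₃ * (‖lbar‖ + 1) with hK
  have hK0 : 0 ≤ L₃ * (‖lbar‖ + 1) := by positivity
  refine ⟨ℓ * K, by positivity, ?_⟩
  filter_upwards [hpert.eventually_mem hU, hlam.eventually_mem hV, hfst.eventually h₁,
    hfst.eventually h₂, hfst.eventually h₃, hbdd] with p hpU hpV hp₁ hp₂ hp₃ hpb hN
  have hmem : p.2.1 ∈ multiplierMap f Φ Θ xbar (Psi f Φ xbar p.2.1, Φ p.1 + p.2.2 - Φ xbar) :=
    mem_kktMap.2 ⟨rfl, by simpa using hN⟩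
  have hsum := hUV _ hpU ⟨hmem, hpV⟩
  rw [multiplierMap_zero, Set.mem_add] at hsum
  obtain ⟨μ, hμ, b, hb, hμb⟩ := hsum
  refine ⟨μ, hμ, ?_⟩
  rw [show p.2.1 - μ = b by rw [← hμb, add_sub_cancel_left]]
  rw [mem_closedBall_zero_iff] at hb
  refine hb.trans ?_
  rw [mul_assoc]
  refine mul_le_mul_of_nonneg_left ?_ hℓ
  have n₁ := norm_nonneg (p.1 - xbar)
  have n₂ := norm_nonneg (Psi f Φ p.1 p.2.1)
  have n₃ := norm_nonneg p.2.2
  have hv : ‖Psi f Φ xbar p.2.1‖ ≤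
      ‖Psi f Φ p.1 p.2.1‖ + (L₁ + L₃ * (‖lbar‖ + 1)) * ‖p.1 - xbar‖ := by
    have heq : Psi f Φ xbar p.2.1 = Psi f Φ p.1 p.2.1 - ((f p.1 - f xbar) +
        ContinuousLinearMap.adjoint (fderiv ℝ Φ p.1 - fderiv ℝ Φ xbar) p.2.1) := by
      simp only [Psi_eq, map_sub, sub_apply]
      abel
    have h4 : ‖ContinuousLinearMap.adjoint (fderiv ℝ Φ p.1 - fderiv ℝ Φ xbar) p.2.1‖ ≤
        L₃ * ‖p.1 - xbar‖ * (‖lbar‖ + 1) := by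
      refine (ContinuousLinearMap.le_opNorm _ _).trans ?_
      rw [LinearIsometryEquiv.norm_map]
      gcongr
    rw [heq]
    refine (norm_sub_le _ _).trans ?_
    have h5 := norm_add_le (f p.1 - f xbar)
      (ContinuousLinearMap.adjoint (fderiv ℝ Φ p.1 - fderiv ℝ Φ xbar) p.2.1)
    linarith
  have hw : ‖Φ p.1 + p.2.2 - Φ xbar‖ ≤ ‖p.2.2‖ + L₂ * ‖p.1 - xbar‖ := by
    have heq : Φ p.1 + p.2.2 - Φ xbar = p.2.2 + (Φ p.1 - Φ xbar) := by abel
    rw [heq]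
    exact (norm_add_le _ _).trans (by gcongr)
  have m₁ : 0 ≤ L₂ * ‖p.1 - xbar‖ := by positivity
  have m₂ : 0 ≤ (L₁ + L₃ * (‖lbar‖ + 1)) * ‖p.1 - xbar‖ := by positivity
  have m₃ : 0 ≤ (L₁ + L₂ + L₃ * (‖lbar‖ + 1)) * (‖Psi f Φ p.1 p.2.1‖ + ‖p.2.2‖) := by positivity
  rw [Prod.mk_sub_mk, sub_zero, sub_zero, Prod.norm_def]
  refine max_le ?_ ?_ <;> simp only [hK] <;> nlinarith

theorem _root_.Ultrafilter.exists_tendsto_of_norm_le {ι F : Type*} [NormedAddCommGroup F]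
    [ProperSpace F] (U : Ultrafilter ι) {g : ι → F} {M : ℝ} (h : ∀ᶠ k in U, ‖g k‖ ≤ M) :
    ∃ a, Tendsto g U (𝓝 a) := by
  obtain ⟨a, -, ha⟩ := (isCompact_closedBall (0 : F) M).ultrafilter_le_nhds (U.map g)
    (le_principal_iff.2 (h.mono fun k hk => mem_closedBall_zero_iff.2 hk))
  exact ⟨a, ha⟩

variable {E : Type*} [NormedAddCommGroup E] [InnerProductSpace ℝ E] [FiniteDimensional ℝ E]
  {C : ProperCone ℝ E} {h : Y → E} {S : Y → E →L[ℝ] Y}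

/-- The limit of the difference quotients `(lam k - lam' k) / t k` between normals `lam k` at
`z + t k • u k` and multipliers `lam' k` belongs to `DN_Θ(z, lbar)(∇Φ(xbar) ξ)`, where
`z = Φ(xbar)`, up to an element of `ker ∇Φ(xbar)^*`, which the linearized equation does not see.
Closedness of `K^* - (K^* ∩ ker ∇Φ(xbar)^*)` is used for the passage to the limit, since `lam' k`
need not approach `lbar` at the rate `t k`. -/
theorem LocalReduction.exists_sub_mem_graphicalDeriv
    (H : LocalReduction Θ (Φ xbar) C h S) (hsol : IsKKTSolution f Φ Θ xbar lbar)
    (hclosed : IsClosed (polarDiffSet Φ Θ xbar lbar)) {ι : Type*} {l : Filter ι} [l.NeBot]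
    {t : ι → ℝ} {u lam lam' : ι → Y} {ξ : X} {η : Y} (ht : ∀ᶠ k in l, 0 < t k)
    (ht0 : Tendsto t l (𝓝 0)) (hu : Tendsto u l (𝓝 (fderiv ℝ Φ xbar ξ)))
    (hlam : Tendsto lam l (𝓝 lbar))
    (hN : ∀ᶠ k in l, lam k ∈ normalCone Θ (Φ xbar + t k • u k))
    (hlam' : ∀ᶠ k in l, lam' k ∈ multipliers f Φ Θ xbar)
    (hη : Tendsto (fun k => (t k)⁻¹ • (lam k - lam' k)) l (𝓝 η)) :
    ∃ η₂ : Y, derivAdj Φ xbar η₂ = 0 ∧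
      η + η₂ ∈ graphicalDeriv (normalCone Θ) (Φ xbar) lbar (fderiv ℝ Φ xbar ξ) := by
  set z := Φ xbar with hz
  set A := fderiv ℝ h z with hA
  set u₀ := fderiv ℝ Φ xbar ξ with hu₀
  set μ := ContinuousLinearMap.adjoint (S z) lbar with hμdef
  have hR : A.comp (S z) = .id ℝ E := H.rightInverse.self_of_nhds
  obtain ⟨-, -, hAμ⟩ := H.eventually_normalCone.self_of_nhds lbar hsol.2
  have hzt : Tendsto (fun k => z + t k • u k) l (𝓝 z) := by
    simpa using tendsto_const_nhds.add (ht0.smul hu)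
  set m : ι → E := fun k => ContinuousLinearMap.adjoint (S (z + t k • u k)) (lam k) with hm
  set m' : ι → E := fun k => ContinuousLinearMap.adjoint (S z) (lam' k) with hm'
  have hmt : Tendsto m l (𝓝 μ) := by
    have hS : Tendsto (fun k => ContinuousLinearMap.adjoint (S (z + t k • u k))) l
        (𝓝 (ContinuousLinearMap.adjoint (S z))) :=
      (ContinuousLinearMap.adjoint.continuous.tendsto _).comp
        (H.continuousAt.self_of_nhds.tendsto.comp hzt)
    exact tendsto_clm_apply hS hlam
  have hmN : ∀ᶠ k in l, m k ∈ polarCone (C : Set E) ∧ inner ℝ (m k) (h (z + t k • u k)) = 0 ∧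
      ContinuousLinearMap.adjoint (fderiv ℝ h (z + t k • u k)) (m k) = lam k := by
    filter_upwards [hzt.eventually H.eventually_normalCone, hN] with k h1 h2
    exact h1 _ h2
  have hmN' : ∀ᶠ k in l, m' k ∈ polarCone (C : Set E) ∧
      ContinuousLinearMap.adjoint A (m' k) = lam' k := by
    filter_upwards [hlam'] with k h1
    have := H.eventually_normalCone.self_of_nhds _ h1.2
    exact ⟨this.1, this.2.2⟩
  have hCe : ∀ᶠ k in l, h (z + t k • u k) ∈ C := by
    filter_upwards [hzt.eventually H.mem_iff, hN] with k h1 h2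
    exact h1.1 h2.1
  set e : ι → E := fun k => (t k)⁻¹ • h (z + t k • u k) with he
  have het : Tendsto e l (𝓝 (A u₀)) := by
    have := tendsto_inv_smul_sub (H.hasStrictFDerivAt z).hasFDerivAt ht ht0 hu
    simpa only [H.apply_eq_zero, sub_zero] using this
  -- the limit direction is critical
  have huK : u₀ ∈ criticalCone Θ z lbar := by
    refine H.mem_criticalCone_iff.2 ⟨C.isClosed.mem_of_tendsto het ?_, ?_⟩
    · filter_upwards [hCe, ht] with k h1 h2
      exact C.smul_mem h1 (inv_pos.2 h2).le
    · rw [← hAμ, ContinuousLinearMap.adjoint_inner_left]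
      refine tendsto_nhds_unique (hmt.inner het) (tendsto_const_nhds.congr' ?_)
      filter_upwards [hmN] with k h1
      rw [he, real_inner_smul_right, h1.2.1, mul_zero]
  -- `θ` is the part of `η` that is left after removal of the curvature of `h`
  set c := ContinuousLinearMap.adjoint (fderiv ℝ (fderiv ℝ h) z u₀) μ with hc
  set ν : ι → E := fun k => (t k)⁻¹ • (m k - m' k) with hν
  have hθ : Tendsto (fun k => ContinuousLinearMap.adjoint A (ν k)) l (𝓝 (η - c)) := by
    have h1 : Tendsto (fun k => ContinuousLinearMap.adjoint
        ((t k)⁻¹ • (fderiv ℝ h (z + t k • u k) - A))) l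
        (𝓝 (ContinuousLinearMap.adjoint (fderiv ℝ (fderiv ℝ h) z u₀))) :=
      (ContinuousLinearMap.adjoint.continuous.tendsto _).comp
        (tendsto_inv_smul_sub (H.hasFDerivAt_fderiv z) ht ht0 hu)
    refine (hη.sub (tendsto_clm_apply h1 hmt)).congr' ?_
    filter_upwards [hmN, hmN'] with k h2 h3
    simp only [hν, map_smul, map_sub, smul_apply, sub_apply]
    rw [h2.2.2, h3.2, ← smul_sub]
    congr 1
    abel
  have hpolar : ∀ a ∈ polarCone (C : Set E), ∀ s : ℝ, 0 < s →
      s⁻¹ • (ContinuousLinearMap.adjoint A a - lbar) ∈ polarCone (criticalCone Θ z lbar) := by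
    intro a ha s hs w hw
    obtain ⟨hwC, hwl⟩ := H.mem_criticalCone_iff.1 hw
    rw [real_inner_smul_left, inner_sub_left, hwl, sub_zero,
      ContinuousLinearMap.adjoint_inner_left]
    exact mul_nonpos_of_nonneg_of_nonpos (inv_pos.2 hs).le (ha _ hwC)
  have hθmem : η - c ∈ polarDiffSet Φ Θ xbar lbar := by
    refine hclosed.mem_of_tendsto hθ ?_
    filter_upwards [hmN, hmN', ht, hlam'] with k h1 h2 h3 h4
    refine mem_sub.2 ⟨_, hpolar _ h1.1 _ h3, (t k)⁻¹ • (lam' k - lbar), ⟨?_, ?_⟩, ?_⟩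
    · rw [← h2.2]
      exact hpolar _ h2.1 _ h3
    · have h5 : derivAdj Φ xbar (lam' k) = derivAdj Φ xbar lbar :=
        add_left_cancel (h4.1.trans hsol.1.symm)
      change derivAdj Φ xbar _ = 0
      rw [map_smul, map_sub, h5, sub_self, smul_zero]
    · simp only [hν, map_smul, map_sub]
      rw [h2.2, ← smul_sub, sub_sub_sub_cancel_right]
  have hinner : 0 ≤ inner ℝ (η - c) u₀ := by
    have hνt : Tendsto ν l (𝓝 (ContinuousLinearMap.adjoint (S z) (η - c))) := by
      have := ((ContinuousLinearMap.adjoint (S z)).continuous.tendsto _).comp hθ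
      refine this.congr fun k => adjoint_comp_adjoint_of_rightInverse hR _
    have hAν : ContinuousLinearMap.adjoint A (ContinuousLinearMap.adjoint (S z) (η - c)) = η - c :=
      tendsto_nhds_unique (((ContinuousLinearMap.adjoint A).continuous.tendsto _).comp hνt) hθ
    rw [← hAν, ContinuousLinearMap.adjoint_inner_left]
    refine ge_of_tendsto (hνt.inner het) ?_
    filter_upwards [hmN, hmN', hCe, ht] with k h1 h2 h3 h4
    rw [hν, he, real_inner_smul_left, real_inner_smul_right, inner_sub_left, h1.2.1]
    have h5 := h2.1 _ h3
    have h6 := inv_pos.2 h4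
    have : 0 ≤ 0 - inner ℝ (m' k) (h (z + t k • u k)) := by linarith
    positivity
  obtain ⟨η₁, hη₁, η₂, ⟨hη₂, hker⟩, hsub⟩ := mem_sub.1 hθmem
  have hη₂u : inner ℝ η₂ u₀ = 0 := by
    rw [hu₀, ← ContinuousLinearMap.adjoint_inner_left, ← derivAdj_apply]
    rw [show derivAdj Φ xbar η₂ = 0 from hker, inner_zero_left]
  have hη₁u : inner ℝ η₁ u₀ = 0 := by
    refine le_antisymm (hη₁ _ huK) ?_
    rwa [← hsub, inner_sub_left, hη₂u, sub_zero] at hinner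
  refine ⟨η₂, hker, ?_⟩
  have := H.mem_graphicalDeriv_normalCone hsol.2 huK hη₁ hη₁u
  rwa [eq_add_of_sub_eq hsub, ← add_assoc, add_sub_cancel] at this

/-- Noncriticality bounds the deviation of `x` from `xbar` by the residual. -/
theorem LocalReduction.exists_norm_sub_le (hf : Differentiable ℝ f) (hΦ : Differentiable ℝ Φ)
    (hΦ2 : Differentiable ℝ (fderiv ℝ Φ)) (hsol : IsKKTSolution f Φ Θ xbar lbar)
    (H : LocalReduction Θ (Φ xbar) C h S)
    (hclosed : IsClosed (polarDiffSet Φ Θ xbar lbar))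
    (hcalm : IsCalmAt (multiplierMap f Φ Θ xbar) (0, 0) lbar)
    (hcrit : IsNoncritical f Φ Θ xbar lbar) :
    ∃ c : ℝ, 0 ≤ c ∧ ∀ᶠ p : X × Y × Y in 𝓝 (xbar, lbar, 0),
      p.2.1 ∈ normalCone Θ (Φ p.1 + p.2.2) →
        ‖p.1 - xbar‖ ≤ c * (‖Psi f Φ p.1 p.2.1‖ + ‖p.2.2‖) := by
  obtain ⟨κ, hκ, hmult⟩ := exists_multiplier_of_isCalmAt hf hΦ hΦ2 hsol hcalm
  by_contra! hcon
  have hseq : ∀ n : ℕ, ∃ p : X × Y × Y, dist p (xbar, lbar, 0) < 1 / ((n : ℝ) + 1) ∧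
      p.2.1 ∈ normalCone Θ (Φ p.1 + p.2.2) ∧
      ((n : ℝ) + 1) * (‖Psi f Φ p.1 p.2.1‖ + ‖p.2.2‖) < ‖p.1 - xbar‖ := by
    intro n
    have hn : (0 : ℝ) < 1 / ((n : ℝ) + 1) := by positivity
    obtain ⟨p, ⟨hp1, hp2⟩, hp3⟩ :=
      ((hcon (n + 1) (by positivity)).and_eventually (Metric.ball_mem_nhds _ hn)).exists
    exact ⟨p, hp3, hp1, hp2⟩
  choose p hdist hpN hplt using hseq
  set U : Ultrafilter ℕ := hyperfilter ℕ
  have hU : (U : Filter ℕ) ≤ atTop := Nat.hyperfilter_le_atTop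
  have hinv : Tendsto (fun n : ℕ => 1 / ((n : ℝ) + 1)) U (𝓝 0) :=
    tendsto_one_div_add_atTop_nhds_zero_nat.mono_left hU
  have hpt : Tendsto p U (𝓝 (xbar, lbar, 0)) :=
    tendsto_iff_dist_tendsto_zero.2
      (squeeze_zero (fun _ => dist_nonneg) (fun n => (hdist n).le) hinv)
  set x : ℕ → X := fun n => (p n).1 with hx
  set lam : ℕ → Y := fun n => (p n).2.1 with hlamdef
  set w : ℕ → Y := fun n => (p n).2.2 with hw
  set t : ℕ → ℝ := fun n => ‖x n - xbar‖ with ht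
  have hxt : Tendsto x U (𝓝 xbar) := (continuous_fst.tendsto _).comp hpt
  have hlam : Tendsto lam U (𝓝 lbar) :=
    ((continuous_fst.comp continuous_snd).tendsto _).comp hpt
  have htpos : ∀ n, 0 < t n := fun n =>
    lt_of_le_of_lt (by positivity) (hplt n)
  have htev : ∀ᶠ n in (U : Filter ℕ), 0 < t n := .of_forall htpos
  have ht0 : Tendsto t U (𝓝 0) := by
    simpa [ht] using (hxt.sub_const xbar).norm
  have hres : ∀ n, (t n)⁻¹ * (‖Psi f Φ (x n) (lam n)‖ + ‖w n‖) ≤ 1 / ((n : ℝ) + 1) := by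
    intro n
    rw [inv_mul_le_iff₀ (htpos n), mul_one_div, le_div_iff₀ (by positivity), mul_comm]
    exact (hplt n).le
  have hv0 : Tendsto (fun n => (t n)⁻¹ • Psi f Φ (x n) (lam n)) U (𝓝 0) := by
    refine squeeze_zero_norm (fun n => ?_) hinv
    refine le_trans ?_ (hres n)
    rw [norm_smul, norm_inv, Real.norm_of_nonneg (htpos n).le]
    have := inv_pos.2 (htpos n)
    gcongr
    exact le_add_of_nonneg_right (norm_nonneg _)
  have hw0 : Tendsto (fun n => (t n)⁻¹ • w n) U (𝓝 0) := by
    refine squeeze_zero_norm (fun n => ?_) hinv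
    refine le_trans ?_ (hres n)
    rw [norm_smul, norm_inv, Real.norm_of_nonneg (htpos n).le]
    have := inv_pos.2 (htpos n)
    gcongr
    exact le_add_of_nonneg_left (norm_nonneg _)
  -- the normalized displacements converge to a unit vector
  set d : ℕ → X := fun n => (t n)⁻¹ • (x n - xbar) with hd
  have hdn : ∀ n, ‖d n‖ = 1 := by
    intro n
    rw [hd, norm_smul, norm_inv, norm_norm, inv_mul_cancel₀ (htpos n).ne']
  have hxd : ∀ n, x n = xbar + t n • d n := by
    intro n
    rw [hd, smul_inv_smul₀ (htpos n).ne', add_sub_cancel]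
  obtain ⟨ξ, hξ⟩ := U.exists_tendsto_of_norm_le (.of_forall fun n => (hdn n).le)
  have hξ1 : ‖ξ‖ = 1 :=
    tendsto_nhds_unique hξ.norm (by simp only [hdn]; exact tendsto_const_nhds)
  -- calmness yields multipliers at distance of the order of the displacement
  obtain ⟨lam', hlam'⟩ : ∃ lam' : ℕ → Y, ∀ᶠ n in (U : Filter ℕ),
      lam' n ∈ multipliers f Φ Θ xbar ∧
      ‖lam n - lam' n‖ ≤ κ * (t n + (‖Psi f Φ (x n) (lam n)‖ + ‖w n‖)) :=
    ((hpt.eventually hmult).mono fun n hn => hn (hpN n)).choice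
  have hηb : ∀ᶠ n in (U : Filter ℕ), ‖(t n)⁻¹ • (lam n - lam' n)‖ ≤ κ * 2 := by
    filter_upwards [hlam'] with n hn
    rw [norm_smul, norm_inv, Real.norm_of_nonneg (htpos n).le, inv_mul_le_iff₀ (htpos n)]
    refine hn.2.trans ?_
    rw [mul_left_comm]
    refine mul_le_mul_of_nonneg_left ?_ hκ
    have h1 := hres n
    rw [inv_mul_le_iff₀ (htpos n)] at h1
    have h2 : 1 / ((n : ℝ) + 1) ≤ 1 := by
      rw [div_le_one (by positivity)]
      linarith [(Nat.cast_nonneg n : (0 : ℝ) ≤ n)]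
    nlinarith [htpos n]
  obtain ⟨η, hη⟩ := U.exists_tendsto_of_norm_le hηb
  have hlamt' : Tendsto lam' U (𝓝 lbar) := by
    have h1 := hlam.sub (ht0.smul hη)
    rw [zero_smul, sub_zero] at h1
    refine h1.congr fun n => ?_
    rw [smul_inv_smul₀ (htpos n).ne', sub_sub_cancel]
  set u : ℕ → Y := fun n => (t n)⁻¹ • (Φ (xbar + t n • d n) - Φ xbar) + (t n)⁻¹ • w n with hu
  have hut : Tendsto u U (𝓝 (fderiv ℝ Φ xbar ξ)) := by
    simpa using (tendsto_inv_smul_sub (hΦ xbar).hasFDerivAt htev ht0 hξ).add hw0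
  have hN : ∀ n, lam n ∈ normalCone Θ (Φ xbar + t n • u n) := by
    intro n
    have h1 : Φ xbar + t n • u n = Φ (x n) + w n := by
      simp only [hu]
      rw [← hxd, smul_add, smul_inv_smul₀ (htpos n).ne', smul_inv_smul₀ (htpos n).ne']
      abel
    rw [h1]
    exact hpN n
  obtain ⟨η₂, hη₂, hDN⟩ := H.exists_sub_mem_graphicalDeriv hsol hclosed htev ht0 hut hlam
    (.of_forall hN) (hlam'.mono fun n hn => hn.1) hη
  -- the linearized equation for `(ξ, η)`
  have hlin : fderiv ℝ (fun y => Psi f Φ y lbar) xbar ξ + derivAdj Φ xbar η = 0 := by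
    have hA : Tendsto (fun n => ContinuousLinearMap.adjoint (fderiv ℝ Φ (x n))) U
        (𝓝 (ContinuousLinearMap.adjoint (fderiv ℝ Φ xbar))) :=
      ((ContinuousLinearMap.adjoint.continuous.comp hΦ2.continuous).tendsto xbar).comp hxt
    have hD : Tendsto (fun n => ContinuousLinearMap.adjoint
        ((t n)⁻¹ • (fderiv ℝ Φ (xbar + t n • d n) - fderiv ℝ Φ xbar))) U
        (𝓝 (ContinuousLinearMap.adjoint (fderiv ℝ (fderiv ℝ Φ) xbar ξ))) :=
      (ContinuousLinearMap.adjoint.continuous.tendsto _).comp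
        (tendsto_inv_smul_sub (hΦ2 xbar).hasFDerivAt htev ht0 hξ)
    have h1 := ((tendsto_inv_smul_sub (hasFDerivAt_Psi hf hΦ2 xbar lbar) htev ht0 hξ).add
      (tendsto_clm_apply hD (hlamt'.sub_const lbar))).add (tendsto_clm_apply hA hη)
    rw [sub_self, map_zero, add_zero, ← derivAdj_apply] at h1
    refine tendsto_nhds_unique h1 (hv0.congr' ?_)
    filter_upwards [hlam'] with n hn
    have h2 : ContinuousLinearMap.adjoint (fderiv ℝ Φ xbar) (lam' n) =
        ContinuousLinearMap.adjoint (fderiv ℝ Φ xbar) lbar := by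
      rw [← derivAdj_apply, ← derivAdj_apply]
      exact add_left_cancel (hn.1.1.trans hsol.1.symm)
    rw [← hxd, hsol.1]
    simp only [Psi_eq, map_smul, map_sub, smul_apply, sub_apply, h2]
    module
  have hξ0 : ξ = 0 := hcrit ξ ⟨_, hDN, by rw [map_add, hη₂, add_zero, hlin]⟩
  rw [hξ0, norm_zero] at hξ1
  exact zero_ne_one hξ1

theorem LocalReduction.hasResidualBound (hf : Differentiable ℝ f) (hΦ : Differentiable ℝ Φ)
    (hΦ2 : Differentiable ℝ (fderiv ℝ Φ)) (hsol : IsKKTSolution f Φ Θ xbar lbar)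
    (H : LocalReduction Θ (Φ xbar) C h S)
    (hclosed : IsClosed (polarDiffSet Φ Θ xbar lbar))
    (hcalm : IsCalmAt (multiplierMap f Φ Θ xbar) (0, 0) lbar)
    (hcrit : IsNoncritical f Φ Θ xbar lbar) : HasResidualBound f Φ Θ xbar lbar := by
  obtain ⟨κ, hκ, hmult⟩ := exists_multiplier_of_isCalmAt hf hΦ hΦ2 hsol hcalm
  obtain ⟨c, hc, hx⟩ := H.exists_norm_sub_le hf hΦ hΦ2 hsol hclosed hcalm hcrit
  refine ⟨c + κ * (c + 1), by positivity, ?_⟩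
  filter_upwards [hmult, hx] with p h1 h2 hN
  have h3 := h2 hN
  obtain ⟨μ, hμ, h4⟩ := h1 hN
  set r := ‖Psi f Φ p.1 p.2.1‖ + ‖p.2.2‖ with hr
  have hr0 : 0 ≤ r := by positivity
  refine ⟨h3.trans (mul_le_mul_of_nonneg_right (le_add_of_nonneg_right (by positivity)) hr0),
    μ, hμ, h4.trans ?_⟩
  have h5 : κ * (‖p.1 - xbar‖ + r) ≤ κ * (c * r + r) := by gcongr
  nlinarith [mul_nonneg hc hr0]

end Calm

end VarSys

theorem theorem5p6
    {X : Type*} [NormedAddCommGroup X] [InnerProductSpace ℝ X] [FiniteDimensional ℝ X]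
    {Y : Type*} [NormedAddCommGroup Y] [InnerProductSpace ℝ Y] [FiniteDimensional ℝ Y]
    (f : X → X) (hf : Differentiable ℝ f)
    (Φ : X → Y) (hΦ : Differentiable ℝ Φ) (hΦ2 : Differentiable ℝ (fderiv ℝ Φ))
    (Θ : Set Y) (hΘ : IsClosed Θ)
    (xbar : X) (lbar : Y) (hsol : VarSys.IsKKTSolution f Φ Θ xbar lbar) :
    ((VarSys.HasErrorBound f Φ Θ xbar lbar ↔ VarSys.IsSemiIsolatedlyCalm f Φ Θ xbar lbar) ∧
      (VarSys.IsSemiIsolatedlyCalm f Φ Θ xbar lbar → VarSys.IsNoncritical f Φ Θ xbar lbar)) ∧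
    (∀ (E : Type*) [NormedAddCommGroup E] [InnerProductSpace ℝ E] [FiniteDimensional ℝ E]
      (C : ProperCone ℝ E),
      VarSys.IsC2ConeReducibleAt Θ (Φ xbar) C →
      IsClosed (VarSys.polarDiffSet Φ Θ xbar lbar) →
      VarSys.IsCalmAt (VarSys.multiplierMap f Φ Θ xbar) (0, 0) lbar →
      VarSys.IsNoncritical f Φ Θ xbar lbar → VarSys.IsSemiIsolatedlyCalm f Φ Θ xbar lbar) := by
  have hcalm := VarSys.isSemiIsolatedlyCalm_iff_hasResidualBound hf hΦ2 hsol
  refine ⟨⟨(VarSys.hasErrorBound_iff_hasResidualBound hsol).trans hcalm.symm, fun h =>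
    (hcalm.1 h).isNoncritical hf hΦ hΦ2 hsol⟩, ?_⟩
  intro E _ _ _ C hred hclosed hM hcrit
  obtain ⟨h, S, H⟩ := hred.exists_localReduction
  exact hcalm.2 (H.hasResidualBound hf hΦ hΦ2 hsol hclosed hM hcrit)
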